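/- Let $\mathcal{SC}_0$ be the class of concave, upper semicontinuous functions $\psi:\mathbb R\to[-\infty,\infty)$, not identically $-\infty$, with $\psi(-x)=\psi(x)$ for all $x$; write $\mathrm{dom}(\psi)=\{x:\psi(x)>-\infty\}$. For a distribution function $F$ on $\mathbb R$, $\theta\in\mathbb R$ and $\psi\in\mathcal{SC}_0$ put \[\Psi(\theta,\psi,F)=\int_{-\infty}^{\infty}\psi(x-\theta)\,dF(x)-\int_{-\infty}^{\infty}e^{\psi(x-\theta)}\,dx\in[-\infty,\infty),\qquad L(F)=\sup_{\theta\in\mathbb R,\ \psi\in\mathcal{SC}_0}\Psi(\theta,\psi,F).\] Let $d_W(F,G)=\int_{-\infty}^{\infty}|F(x)-G(x)|\,dx$. Condition A: $F$ is non-degenerate (not a point mass) and $\int|x|\,dF(x)<\infty$. Condition B: if $(\theta_1,\psi_1)$ and $(\theta_2,\psi_2)$ both maximize $\Psi(\cdot,\cdot,F)$ over $\mathbb R\times\mathcal{SC}_0$, then $\theta_1=\theta_2$. Theorem. Let $F$ and $F_n$ ($n\ge1$) be distribution functions satisfying Conditions A and B, with $d_W(F_n,F)\to0$. Then for $G=F$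 and for each $G=F_n$ there is exactly one maximizer $(\theta^*(G),\psi^*(G))$ of $\Psi(\cdot,\cdot,G)$ over $\mathbb R\times\mathcal{SC}_0$, and, with $g^*(G)=e^{\psi^*(G)}$, as $n\to\infty$ we have $L(F_n)\to L(F)$ and: (a) $\theta^*(F_n)\to\theta^*(F)$. (b) $\psi^*(F_n)(x)\to\psi^*(F)(x)$ for all $x$ in the interior of $\mathrm{dom}(\psi^*(F))$. (c) $\limsup_n\psi^*(F_n)(x)\le\psi^*(F)(x)$ for all $x\in\mathbb R$. (d) $g^*(F_n)(x)\to g^*(F)(x)$ for all $x\in\mathbb R$, except possibly at boundary points $x$ of $\mathrm{dom}(\psi^*(F))$ with $g^*(F)(x)>0$. (e) There is $\alpha>0$ such that for all $\alpha_1<\alpha$, \[\lim_{n\to\infty}\int_{-\infty}^{\infty}e^{\alpha_1|x|}\,\bigl|g^*(F_n)(x)-g^*(F)(x)\bigr|\,dx=0;\] moreover, if $g^*(F)$ is continuous on $\mathbb R$, then $\sup_{x\in\mathbb R}e^{\alpha_1|x|}\,|g^*(F_n)(x)-g^*(F)(x)|\to0$. -/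

import Mathlib

open Filter Topology MeasureTheory ProbabilityTheory
open scoped ENNReal

namespace SymLogConcave

/-- The effective domain `{x | ψ x > -∞}` of a function with values in `[-∞, ∞]`. -/
def dom (ψ : ℝ → EReal) : Set ℝ := {x | ⊥ < ψ x}

/-- The class `𝒞` of closed proper concave functions `φ : ℝ → [-∞, ∞)`. Concavity means that the
hypograph is convex; a proper concave function is closed iff it is upper semicontinuous. -/
structure IsClosedProperConcave (φ : ℝ → EReal) : Prop where
  concave : Convex ℝ {p : ℝ × ℝ | (p.2 : EReal) ≤ φ p.1}
  closed : UpperSemicontinuous φ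
  lt_top : ∀ x, φ x < ⊤
  dom_nonempty : (dom φ).Nonempty

/-- The class `𝒮𝒞_θ` of members of `𝒞` that are symmetric about `θ`. -/
def SC (θ : ℝ) : Set (ℝ → EReal) :=
  {φ | IsClosedProperConcave φ ∧ ∀ x, φ (θ + x) = φ (θ - x)}

/-- The integral of an extended-real-valued function, as the difference of the integrals of its
positive and its negative part. (It is only used for measurable functions that are bounded above
and for finite measures, so that the first of these is finite.) -/
noncomputable def extIntegral (P : Measure ℝ) (f : ℝ → EReal) : EReal :=
  ((∫⁻ x, (f x).toENNReal ∂P : ℝ≥0∞) : EReal) - ((∫⁻ x, (-f x).toENNReal ∂P : ℝ≥0∞) : EReal)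

/-- The criterion function `Ψ(θ, ψ, F) = ∫ ψ(x - θ) dF(x) - ∫ exp (ψ(x - θ)) dx`, where the
distribution function `F` is given by its probability measure. -/
noncomputable def Psi (θ : ℝ) (ψ : ℝ → EReal) (F : Measure ℝ) : EReal :=
  extIntegral F (fun x => ψ (x - θ)) - ((∫⁻ x, EReal.exp (ψ (x - θ)) : ℝ≥0∞) : EReal)

/-- The maximized criterion function `L(F) = sup_{θ, ψ} Ψ(θ, ψ, F)`. -/
noncomputable def L (F : Measure ℝ) : EReal :=
  ⨆ (θ : ℝ) (ψ : ℝ → EReal) (_ : ψ ∈ SC 0), Psi θ ψ F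

/-- `(θ, ψ)` maximizes `Ψ(·, ·, F)` over `ℝ × 𝒮𝒞_0`. -/
def IsMaximizer (F : Measure ℝ) (θ : ℝ) (ψ : ℝ → EReal) : Prop :=
  ψ ∈ SC 0 ∧ ∀ θ' : ℝ, ∀ ψ' ∈ SC 0, Psi θ' ψ' F ≤ Psi θ ψ F

/-- A pair `(θ*(F), ψ*(F))` in the argmax of `Ψ(·, ·, F)` (arbitrary if there is none). -/
noncomputable def argmaxPair (F : Measure ℝ) : ℝ × (ℝ → EReal) :=
  Classical.epsilon fun q => IsMaximizer F q.1 q.2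

/-- `θ*(F)`. -/
noncomputable def thetaStar (F : Measure ℝ) : ℝ := (argmaxPair F).1

/-- `ψ*(F)`. -/
noncomputable def psiStar (F : Measure ℝ) : ℝ → EReal := (argmaxPair F).2

/-- `g*(F) = exp (ψ*(F))`. -/
noncomputable def gStar (F : Measure ℝ) (x : ℝ) : ℝ := (EReal.exp (psiStar F x)).toReal

/-- The Wasserstein distance `∫ |F(x) - G(x)| dx` of two distribution functions. -/
noncomputable def dW (F G : Measure ℝ) : ℝ≥0∞ :=
  ∫⁻ x, ENNReal.ofReal |cdf F x - cdf G x|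

/-- Condition A: non-degenerate, with finite first moment. -/
def ConditionA (F : Measure ℝ) : Prop :=
  (∀ a : ℝ, F ≠ Measure.dirac a) ∧ ∫⁻ x, ENNReal.ofReal |x| ∂F < ∞

/-- Condition B: the first component of a maximizer of `Ψ(·, ·, F)` is unique. Its existence is
not assumed. -/
def ConditionB (F : Measure ℝ) : Prop :=
  ∀ θ₁ θ₂ ψ₁ ψ₂, IsMaximizer F θ₁ ψ₁ → IsMaximizer F θ₂ ψ₂ → θ₁ = θ₂

end SymLogConcave

/-! The argument is the direct method of the calculus of variations, run along the sequence `Fn`.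

Compactness: if `∫ exp ψ ≤ 1` and `ψ 0 = M`, concavity and symmetry force `ψ x ≤ M + 1 - 2 exp (M -
1) |x|` (`SC_bound`). Integrating, a lower bound on `Psi` confines `M` and `θ`, because
non-degeneracy keeps `∫ |x - θ| dF` away from `0` uniformly in `θ`, stably under `dW`
(`eventually_uniform_bound`). A Helly selection (`SC_seq_compact`) then yields limits of the `ψ`'s.

Semicontinuity: quantile functions realise all laws on one space, and `dW` dominates their L¹
distance, so along a subsequence they converge almost everywhere. Fatou's lemma then gives upper
semicontinuity of `Psi` (`cost_le_liminf`, `exists_subseq_limit`). Conversely, replacing a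
near-optimal `ψ` by a Lipschitz majorant, whose integral is continuous under `dW`, gives `L F ≤
liminf L (Fn)` (`eventually_lt_L`).

Hence maximizers exist, and subsequential limits of maximizers for `Fn` maximize for `F`. For fixed
`θ` the maximizing `ψ` is unique by strict convexity of `exp`; with Condition B the limit is always
the same pair, so the full sequence converges. Assertion (e) adds a common exponential envelope to
this pointwise convergence: dominated convergence for the integral, monotonicity in `|x|` for the
supremum. -/

namespace SymLogConcave

/-! ### Quantile coupling and the Wasserstein distance -/

/-- The quantile function of a distribution, set to `0` outside `(0, 1)`. -/
noncomputable def quantile (P : Measure ℝ) (u : ℝ) : ℝ :=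
  if u ∈ Set.Ioo (0 : ℝ) 1 then sInf {x | u ≤ cdf P x} else 0

/-- The uniform distribution on `(0, 1)`. -/
noncomputable def unif : Measure ℝ := volume.restrict (Set.Ioo 0 1)

instance : IsProbabilityMeasure unif := ⟨by simp [unif]⟩

theorem quantile_le_iff (P : Measure ℝ) {u : ℝ} (hu : u ∈ Set.Ioo (0 : ℝ) 1) (x : ℝ) :
    quantile P u ≤ x ↔ u ≤ cdf P x := by
  rw [quantile, if_pos hu]
  have hne : {x | u ≤ cdf P x}.Nonempty := by
    obtain ⟨y, hy⟩ := ((tendsto_cdf_atTop P).eventually (lt_mem_nhds hu.2)).exists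
    exact ⟨y, hy.le⟩
  have hbdd : BddBelow {x | u ≤ cdf P x} := by
    obtain ⟨y, hy⟩ := ((tendsto_cdf_atBot P).eventually (gt_mem_nhds hu.1)).exists
    refine ⟨y, fun z hz => ?_⟩
    by_contra h
    exact absurd (hz.trans (monotone_cdf P (not_le.1 h).le)) (not_le.2 hy)
  constructor
  · intro h
    have hr : Tendsto (cdf P) (𝓝[>] x) (𝓝 (cdf P x)) :=
      ((cdf P).right_continuous x).tendsto.mono_left (nhdsWithin_mono _ Set.Ioi_subset_Ici_self)
    refine ge_of_tendsto hr ?_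
    filter_upwards [self_mem_nhdsWithin] with y hy
    obtain ⟨z, hz, hzy⟩ := exists_lt_of_csInf_lt hne (h.trans_lt hy)
    exact le_trans hz (monotone_cdf P hzy.le)
  · intro h
    exact csInf_le hbdd h

theorem measurable_quantile (P : Measure ℝ) : Measurable (quantile P) := by
  refine measurable_of_Iic fun x => ?_
  have : quantile P ⁻¹' Set.Iic x =
      (Set.Ioo 0 1 ∩ Set.Iic (cdf P x)) ∪ ((Set.Ioo (0 : ℝ) 1)ᶜ ∩ {_u | (0 : ℝ) ≤ x}) := by
    ext u
    by_cases hu : u ∈ Set.Ioo (0 : ℝ) 1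
    · have := quantile_le_iff P hu x
      simp only [Set.mem_preimage, Set.mem_Iic, Set.mem_union, Set.mem_inter_iff, hu, true_and,
        Set.mem_compl_iff, not_true, false_and, or_false, this]
    · simp only [Set.mem_preimage, Set.mem_Iic, Set.mem_union, Set.mem_inter_iff, hu, false_and,
        Set.mem_compl_iff, not_false_iff, true_and, false_or, Set.mem_ofPred_eq]
      rw [quantile, if_neg hu]
  rw [this]
  exact (measurableSet_Ioo.inter measurableSet_Iic).union
    (measurableSet_Ioo.compl.inter (MeasurableSet.const _))

theorem map_quantile (P : Measure ℝ) [IsProbabilityMeasure P] : unif.map (quantile P) = P := by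
  have : IsProbabilityMeasure (unif.map (quantile P)) :=
    Measure.isProbabilityMeasure_map (measurable_quantile P).aemeasurable
  refine Measure.ext_of_Iic _ _ fun x => ?_
  rw [Measure.map_apply (measurable_quantile P) measurableSet_Iic, unif,
    Measure.restrict_apply (measurable_quantile P measurableSet_Iic)]
  have h1 : quantile P ⁻¹' Set.Iic x ∩ Set.Ioo 0 1 = Set.Iic (cdf P x) ∩ Set.Ioo 0 1 := by
    ext u
    constructor <;> rintro ⟨h, hu⟩
    · exact ⟨(quantile_le_iff P hu x).1 h, hu⟩
    · exact ⟨(quantile_le_iff P hu x).2 h, hu⟩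
  rw [h1, ← ofReal_cdf P x]
  apply le_antisymm
  · calc volume (Set.Iic (cdf P x) ∩ Set.Ioo 0 1) ≤ volume (Set.Ioc 0 (cdf P x)) :=
          measure_mono fun u hu => ⟨hu.2.1, hu.1⟩
      _ = ENNReal.ofReal (cdf P x) := by simp
  · calc ENNReal.ofReal (cdf P x) = volume (Set.Ioo 0 (cdf P x)) := by simp
      _ ≤ volume (Set.Iic (cdf P x) ∩ Set.Ioo 0 1) :=
          measure_mono fun u hu => ⟨hu.2.le, hu.1, hu.2.trans_le (cdf_le_one P x)⟩

theorem lintegral_quantile (P : Measure ℝ) [IsProbabilityMeasure P] {f : ℝ → ℝ≥0∞}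
    (hf : Measurable f) : ∫⁻ x, f x ∂P = ∫⁻ u, f (quantile P u) ∂unif := by
  conv_lhs => rw [← map_quantile P]
  rw [lintegral_map hf (measurable_quantile P)]

/-- Tonelli for the region `S` between the two cdf graphs: its slice at level `u` contains the
interval between the quantiles, and its slice at `x` lies in the interval between the cdf values. -/
theorem lintegral_quantile_sub_le (P R : Measure ℝ) :
    ∫⁻ u, ENNReal.ofReal |quantile P u - quantile R u| ∂unif ≤ dW P R := by
  let S : Set (ℝ × ℝ) := {p | p.1 ≤ cdf P p.2 ∧ cdf R p.2 < p.1} ∪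
    {p | p.1 ≤ cdf R p.2 ∧ cdf P p.2 < p.1}
  have mP : Measurable fun p : ℝ × ℝ => cdf P p.2 := (monotone_cdf P).measurable.comp measurable_snd
  have mR : Measurable fun p : ℝ × ℝ => cdf R p.2 := (monotone_cdf R).measurable.comp measurable_snd
  have hS : MeasurableSet S :=
    ((measurableSet_le measurable_fst mP).inter (measurableSet_lt mR measurable_fst)).union
      ((measurableSet_le measurable_fst mR).inter (measurableSet_lt mP measurable_fst))
  have h1 : ∀ u ∈ Set.Ioo (0 : ℝ) 1, ENNReal.ofReal |quantile P u - quantile R u| ≤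
      ∫⁻ x, S.indicator 1 (u, x) := by
    intro u hu
    have e : (fun x => S.indicator (1 : ℝ × ℝ → ℝ≥0∞) (u, x)) =
        ((fun x => (u, x)) ⁻¹' S).indicator 1 := by
      ext x; simp [Set.indicator]
    rw [e, lintegral_indicator_one (measurable_prodMk_left hS)]
    rcases le_total (quantile P u) (quantile R u) with h | h
    · rw [abs_of_nonpos (by linarith), neg_sub, ← Real.volume_Ico]
      refine measure_mono fun x hx => Or.inl ⟨(quantile_le_iff P hu x).1 hx.1, ?_⟩
      exact not_le.1 fun hh => absurd ((quantile_le_iff R hu x).2 hh) (not_le.2 hx.2)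
    · rw [abs_of_nonneg (by linarith), ← Real.volume_Ico]
      refine measure_mono fun x hx => Or.inr ⟨(quantile_le_iff R hu x).1 hx.1, ?_⟩
      exact not_le.1 fun hh => absurd ((quantile_le_iff P hu x).2 hh) (not_le.2 hx.2)
  have h2 : ∀ x, ∫⁻ u, S.indicator 1 (u, x) ∂unif ≤ ENNReal.ofReal |cdf P x - cdf R x| := by
    intro x
    have e : (fun u => S.indicator (1 : ℝ × ℝ → ℝ≥0∞) (u, x)) =
        ((fun u => (u, x)) ⁻¹' S).indicator 1 := by
      ext x; simp [Set.indicator]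
    rw [e, lintegral_indicator_one (measurable_prodMk_right hS)]
    refine (Measure.restrict_apply_le _ _).trans ?_
    rcases le_total (cdf P x) (cdf R x) with h | h
    · rw [abs_of_nonpos (by linarith), neg_sub, ← Real.volume_Ioc]
      refine measure_mono fun u hu => ?_
      rcases hu with ⟨h1, h2⟩ | ⟨h1, h2⟩
      · exact absurd (h2.trans_le h1) (not_lt.2 h)
      · exact ⟨h2, h1⟩
    · rw [abs_of_nonneg (by linarith), ← Real.volume_Ioc]
      refine measure_mono fun u hu => ?_
      rcases hu with ⟨h1, h2⟩ | ⟨h1, h2⟩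
      · exact ⟨h2, h1⟩
      · exact absurd (h2.trans_le h1) (not_lt.2 h)
  calc ∫⁻ u, ENNReal.ofReal |quantile P u - quantile R u| ∂unif
      ≤ ∫⁻ u, ∫⁻ x, S.indicator 1 (u, x) ∂volume ∂unif :=
        setLIntegral_mono' measurableSet_Ioo h1
    _ = ∫⁻ x, ∫⁻ u, S.indicator 1 (u, x) ∂unif :=
        lintegral_lintegral_swap (measurable_one.indicator hS).aemeasurable
    _ ≤ _ := lintegral_mono h2

/-! ### The criterion as a constant minus a nonnegative cost -/

theorem extIntegral_mono (P : Measure ℝ) {f g : ℝ → EReal} (h : ∀ x, f x ≤ g x) :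
    extIntegral P f ≤ extIntegral P g := by
  unfold extIntegral
  refine EReal.sub_le_sub ?_ ?_
  · exact EReal.coe_ennreal_le_coe_ennreal_iff.2
      (lintegral_mono fun x => EReal.toENNReal_le_toENNReal (h x))
  · exact EReal.coe_ennreal_le_coe_ennreal_iff.2
      (lintegral_mono fun x => EReal.toENNReal_le_toENNReal (EReal.neg_le_neg_iff.2 (h x)))

theorem extIntegral_coe (P : Measure ℝ) {f : ℝ → ℝ} (hf : Integrable f P) :
    extIntegral P (fun x => (f x : EReal)) = ((∫ x, f x ∂P : ℝ) : EReal) := by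
  have h1 : ∫⁻ x, ENNReal.ofReal (f x) ∂P ≠ ⊤ := hf.lintegral_lt_top.ne
  have h2 : ∫⁻ x, ENNReal.ofReal (-f x) ∂P ≠ ⊤ := hf.neg.lintegral_lt_top.ne
  rw [extIntegral, integral_eq_lintegral_pos_part_sub_lintegral_neg_part hf]
  simp only [← EReal.coe_neg, EReal.real_coe_toENNReal]
  rw [EReal.coe_sub, ← EReal.coe_ennreal_toReal h1, ← EReal.coe_ennreal_toReal h2]

theorem EReal_cases_of_lt_top {x : EReal} (h : x < ⊤) : x = ⊥ ∨ ∃ r : ℝ, x = r := by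
  induction x with
  | bot => exact Or.inl rfl
  | coe r => exact Or.inr ⟨r, rfl⟩
  | top => exact absurd h (lt_irrefl _)

theorem toENNReal_sub_add_toENNReal {a : ℝ} (ha : 0 ≤ a) {x : EReal} (hx : x ≤ a) :
    ((a : EReal) - x).toENNReal + x.toENNReal = ENNReal.ofReal a + (-x).toENNReal := by
  rcases EReal_cases_of_lt_top (hx.trans_lt (EReal.coe_lt_top a)) with rfl | ⟨r, rfl⟩
  · simp
  · have hr : r ≤ a := by exact_mod_cast hx
    rw [← EReal.coe_sub, ← EReal.coe_neg]
    simp only [EReal.real_coe_toENNReal]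
    rcases le_total 0 r with h | h
    · rw [ENNReal.ofReal_of_nonpos (by linarith : -r ≤ 0), add_zero,
        ← ENNReal.ofReal_add (by linarith) h]
      congr 1; ring
    · rw [ENNReal.ofReal_of_nonpos h, add_zero, ← ENNReal.ofReal_add ha (by linarith)]
      rfl

/-- The positive part has finite integral, so the pointwise identity `toENNReal_sub_add_toENNReal`
can be integrated and rearranged; both sides are `⊥` exactly when the negative part has infinite
integral. -/
theorem extIntegral_eq_sub (P : Measure ℝ) [IsProbabilityMeasure P] {f : ℝ → EReal}
    (hf : Measurable f) {a : ℝ} (ha : 0 ≤ a) (hfa : ∀ x, f x ≤ a) :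
    extIntegral P f = (a : EReal) - ((∫⁻ x, ((a : EReal) - f x).toENNReal ∂P : ℝ≥0∞) : EReal) := by
  have key : ∫⁻ x, ((a : EReal) - f x).toENNReal ∂P + ∫⁻ x, (f x).toENNReal ∂P =
      ENNReal.ofReal a + ∫⁻ x, (-f x).toENNReal ∂P := by
    rw [← lintegral_add_right _ hf.ereal_toENNReal]
    simp_rw [fun x => toENNReal_sub_add_toENNReal ha (hfa x)]
    rw [lintegral_add_left measurable_const]
    simp
  have hp : ∫⁻ x, (f x).toENNReal ∂P ≠ ⊤ := by
    refine ((lintegral_mono fun x => EReal.toENNReal_le_toENNReal (hfa x)).trans_lt ?_).ne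
    simp
  rw [extIntegral]
  generalize ∫⁻ x, ((a : EReal) - f x).toENNReal ∂P = A at *
  generalize ∫⁻ x, (f x).toENNReal ∂P = p at *
  generalize ∫⁻ x, (-f x).toENNReal ∂P = m at *
  by_cases hA : A = ⊤
  · have hm : m = ⊤ := by
      by_contra hm
      rw [hA, top_add] at key
      exact ENNReal.add_ne_top.2 ⟨ENNReal.ofReal_ne_top, hm⟩ key.symm
    simp [hA, hm]
  · have hm : m ≠ ⊤ := by
      intro hm
      rw [hm, add_top] at key
      exact ENNReal.add_ne_top.2 ⟨hA, hp⟩ key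
    lift A to NNReal using hA
    lift m to NNReal using hm
    lift p to NNReal using hp
    have h := congrArg ENNReal.toReal key
    rw [ENNReal.toReal_add (by simp) (by simp), ENNReal.toReal_add (by simp) (by simp),
      ENNReal.toReal_ofReal ha] at h
    simp only [ENNReal.coe_toReal] at h
    have e : ∀ q : NNReal, (((q : ℝ≥0∞)) : EReal) = ((q : ℝ) : EReal) := fun q => rfl
    rw [e, e, e, ← EReal.coe_sub, ← EReal.coe_sub]
    congr 1
    linarith

/-- The criterion function is `a` minus this cost, for functions `ψ` bounded above by `a`. -/
noncomputable def cost (a : ℝ) (θ : ℝ) (ψ : ℝ → EReal) (F : Measure ℝ) : ℝ≥0∞ :=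
  ∫⁻ x, ((a : EReal) - ψ (x - θ)).toENNReal ∂F + ∫⁻ x, EReal.exp (ψ x)

/-- Maximizing `Psi` becomes minimizing a quantity in `ℝ≥0∞`, where Fatou's lemma and cancellation
apply without any `∞ - ∞`. -/
theorem Psi_eq_sub_cost (F : Measure ℝ) [IsProbabilityMeasure F] {ψ : ℝ → EReal}
    (hψ : Measurable ψ) {a : ℝ} (ha : 0 ≤ a) (hψa : ∀ x, ψ x ≤ a) (θ : ℝ) :
    Psi θ ψ F = (a : EReal) - (cost a θ ψ F : EReal) := by
  rw [Psi, extIntegral_eq_sub F (f := fun x => ψ (x - θ))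
    (hψ.comp (measurable_id.sub_const θ)) ha fun x => hψa _, cost,
    lintegral_sub_right_eq_self (fun x => EReal.exp (ψ x)) θ]
  generalize ∫⁻ x, ((a : EReal) - ψ (x - θ)).toENNReal ∂F = A
  generalize ∫⁻ x, EReal.exp (ψ x) = B
  rw [EReal.coe_ennreal_add, sub_eq_add_neg, sub_eq_add_neg, sub_eq_add_neg, EReal.neg_add,
    sub_eq_add_neg, add_assoc]
  · exact Or.inl (EReal.coe_ennreal_ne_bot _)
  · exact Or.inr (EReal.coe_ennreal_ne_bot _)

theorem coe_sub_le_coe_sub_iff (a : ℝ) (x y : ℝ≥0∞) :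
    (a : EReal) - (x : EReal) ≤ (a : EReal) - (y : EReal) ↔ y ≤ x := by
  constructor
  · intro h
    by_contra hlt
    rw [not_le] at hlt
    have hx : x ≠ ⊤ := hlt.ne_top
    lift x to NNReal using hx
    refine absurd h (not_le.2 ?_)
    have e : ∀ q : NNReal, (((q : ℝ≥0∞)) : EReal) = ((q : ℝ) : EReal) := fun q => rfl
    by_cases hy : y = ⊤
    · rw [hy, e, ← EReal.coe_sub, EReal.coe_ennreal_top, EReal.sub_top]
      exact EReal.bot_lt_coe _
    · lift y to NNReal using hy
      rw [e, e, ← EReal.coe_sub, ← EReal.coe_sub, EReal.coe_lt_coe_iff]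
      have : (x : ℝ) < y := by exact_mod_cast hlt
      linarith
  · intro h
    exact EReal.sub_le_sub le_rfl (EReal.coe_ennreal_le_coe_ennreal_iff.2 h)

theorem coe_sub_coe_eq_bot_iff (a : ℝ) (x : ℝ≥0∞) :
    (a : EReal) - (x : EReal) = ⊥ ↔ x = ⊤ := by
  constructor
  · intro h
    by_contra hx
    lift x to NNReal using hx
    have e : ∀ q : NNReal, (((q : ℝ≥0∞)) : EReal) = ((q : ℝ) : EReal) := fun q => rfl
    rw [e, ← EReal.coe_sub] at h
    exact EReal.coe_ne_bot _ h
  · rintro rfl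
    simp

/-! ### Symmetric concave functions -/

section

variable {ψ : ℝ → EReal}

theorem mem_SC_zero (hc : Convex ℝ {p : ℝ × ℝ | (p.2 : EReal) ≤ ψ p.1})
    (hu : UpperSemicontinuous ψ) (ht : ∀ x, ψ x < ⊤) (hd : ⊥ < ψ 0) (he : ∀ x, ψ x = ψ (-x)) :
    ψ ∈ SC 0 :=
  ⟨⟨hc, hu, ht, ⟨0, hd⟩⟩, fun x => by simpa using he x⟩

theorem SC_even (h : ψ ∈ SC 0) (x : ℝ) : ψ (-x) = ψ x := by
  have := h.2 x
  simpa using this.symm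

theorem SC_abs (h : ψ ∈ SC 0) (x : ℝ) : ψ |x| = ψ x := by
  rcases abs_choice x with e | e <;> rw [e]
  exact SC_even h x

theorem SC_combo (h : ψ ∈ SC 0) {x y s t a b : ℝ} (hs : (s : EReal) ≤ ψ x)
    (ht : (t : EReal) ≤ ψ y) (ha : 0 ≤ a) (hb : 0 ≤ b) (hab : a + b = 1) :
    ((a * s + b * t : ℝ) : EReal) ≤ ψ (a * x + b * y) :=
  h.1.concave (x := (x, s)) hs (y := (y, t)) ht ha hb hab

theorem SC_anti (h : ψ ∈ SC 0) {x y : ℝ} (hxy : |x| ≤ |y|) : ψ y ≤ ψ x := by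
  rcases EReal_cases_of_lt_top (h.1.lt_top y) with e | ⟨r, e⟩
  · rw [e]; exact bot_le
  rcases eq_or_ne y 0 with rfl | hy
  · rw [abs_zero] at hxy
    rw [abs_eq_zero.1 (le_antisymm hxy (abs_nonneg x))]
  have hy' : 0 < |y| := abs_pos.2 hy
  have h1 : (r : EReal) ≤ ψ |y| := by rw [SC_abs h, e]
  have h2 : (r : EReal) ≤ ψ (-|y|) := by rw [SC_even h, SC_abs h, e]
  obtain ⟨hl, hr⟩ := abs_le.1 hxy
  -- `x` is the convex combination of `|y|` and `-|y|` with these weights.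
  have := SC_combo h h1 h2 (a := (1 + x / |y|) / 2) (b := (1 - x / |y|) / 2)
    (by have : -1 ≤ x / |y| := by rw [le_div_iff₀ hy']; linarith
        linarith)
    (by have : x / |y| ≤ 1 := by rw [div_le_iff₀ hy']; linarith
        linarith) (by ring)
  have e1 : (1 + x / |y|) / 2 * r + (1 - x / |y|) / 2 * r = r := by ring
  have e2 : (1 + x / |y|) / 2 * |y| + (1 - x / |y|) / 2 * -|y| = x := by
    field_simp; ring
  rw [e1, e2] at this
  rwa [e]

theorem SC_le_zero (h : ψ ∈ SC 0) (x : ℝ) : ψ x ≤ ψ 0 := SC_anti h (by simp)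

theorem SC_zero_real (h : ψ ∈ SC 0) : ∃ M : ℝ, ψ 0 = M := by
  obtain ⟨x, hx⟩ := h.1.dom_nonempty
  rcases EReal_cases_of_lt_top (h.1.lt_top 0) with e | h'
  · exact absurd (e ▸ hx.trans_le (SC_le_zero h x)) (lt_irrefl _)
  · exact h'

theorem SC_measurable (h : ψ ∈ SC 0) : Measurable ψ := h.1.closed.measurable

/-- If `ψ` has dropped from `M` to `r` at `x`, concavity keeps it above `M - 1` up to distance `|x|
/ s` with `s = max 1 (M - r)`. The mass of `exp ψ` on that symmetric interval is at most `1`, so `2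
exp (M - 1) |x| ≤ s ≤ 1 + M - r`. -/
theorem SC_bound (h : ψ ∈ SC 0) (hI : ∫⁻ x, EReal.exp (ψ x) ≤ 1) {M : ℝ} (hM : ψ 0 = M) (x : ℝ) :
    ψ x ≤ ((M + 1 - 2 * Real.exp (M - 1) * |x| : ℝ) : EReal) := by
  rcases EReal_cases_of_lt_top (h.1.lt_top x) with e | ⟨r, e⟩
  · rw [e]; exact bot_le
  rw [e, EReal.coe_le_coe_iff]
  have hrM : r ≤ M := by
    have := SC_le_zero h x
    rw [e, hM] at this
    exact_mod_cast this
  set s : ℝ := max 1 (M - r) with hs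
  have hs1 : 1 ≤ s := le_max_left _ _
  have hs2 : M - r ≤ s := le_max_right _ _
  have hs0 : 0 < s := by linarith
  have hs3 : s ≤ 1 + (M - r) := max_le (by linarith) (by linarith)
  have h1 : ((M - 1 : ℝ) : EReal) ≤ ψ (|x| / s) := by
    have := SC_combo h (x := 0) (y := |x|) (s := M) (t := r) hM.ge (by rw [SC_abs h, e])
      (a := 1 - 1 / s) (b := 1 / s) (by rw [sub_nonneg, div_le_one hs0]; exact hs1)
      (by positivity) (by ring)
    refine le_trans (EReal.coe_le_coe_iff.2 ?_) (this.trans_eq (by congr 1; ring))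
    have : (M - r) / s ≤ 1 := (div_le_one hs0).2 hs2
    have e2 : (1 - 1 / s) * M + 1 / s * r = M - (M - r) / s := by ring
    linarith
  have h2 : ENNReal.ofReal (Real.exp (M - 1)) * ENNReal.ofReal (2 * (|x| / s)) ≤ 1 := by
    calc ENNReal.ofReal (Real.exp (M - 1)) * ENNReal.ofReal (2 * (|x| / s))
        = ∫⁻ y in Set.Icc (-(|x| / s)) (|x| / s), ENNReal.ofReal (Real.exp (M - 1)) := by
          rw [setLIntegral_const, Real.volume_Icc]; congr 2; ring
      _ ≤ ∫⁻ y in Set.Icc (-(|x| / s)) (|x| / s), EReal.exp (ψ y) := by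
          refine setLIntegral_mono' measurableSet_Icc fun y hy => ?_
          rw [← EReal.exp_coe]
          refine EReal.exp_monotone (h1.trans (SC_anti h ?_))
          rw [abs_of_nonneg (by positivity : 0 ≤ |x| / s)]
          exact abs_le.2 hy
      _ ≤ ∫⁻ y, EReal.exp (ψ y) := setLIntegral_le_lintegral _ _
      _ ≤ 1 := hI
  rw [← ENNReal.ofReal_mul (Real.exp_pos _).le, ENNReal.ofReal_le_one] at h2
  have e3 : Real.exp (M - 1) * (2 * (|x| / s)) = 2 * Real.exp (M - 1) * |x| / s := by ring
  rw [e3, div_le_one hs0] at h2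
  linarith

/-- Interpolating from `|x|` a little way towards `|y|`, a point of the domain, costs arbitrarily
little; so there is no downward jump just outside `|x|`. -/
theorem SC_exists_gt (h : ψ ∈ SC 0) {x y : ℝ} (hxy : |x| < |y|) (hy : ⊥ < ψ y) {t : EReal}
    (ht : t < ψ x) : ∃ z, |x| < z ∧ t < ψ z := by
  rcases EReal_cases_of_lt_top (h.1.lt_top y) with e | ⟨r, e⟩
  · exact absurd e hy.ne'
  have hr : (r : EReal) ≤ ψ |y| := by rw [SC_abs h, e]
  rcases EReal_cases_of_lt_top (h.1.lt_top x) with e' | ⟨s, e'⟩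
  · rw [e'] at ht; exact absurd ht not_lt_bot
  have hs : (s : EReal) ≤ ψ |x| := by rw [SC_abs h, e']
  obtain ⟨t', ht1, ht2⟩ := EReal.lt_iff_exists_real_btwn.1 ht
  rw [e'] at ht2
  have ht2 : t' < s := by exact_mod_cast ht2
  have hc : Tendsto (fun b : ℝ => (1 - b) * s + b * r) (𝓝[>] 0) (𝓝 ((1 - 0) * s + 0 * r)) :=
    (Continuous.tendsto (by fun_prop) 0).mono_left nhdsWithin_le_nhds
  rw [sub_zero, one_mul, zero_mul, add_zero] at hc
  obtain ⟨b, hb1, hb2⟩ := ((hc.eventually (lt_mem_nhds ht2)).and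
    (Ioo_mem_nhdsGT (zero_lt_one' ℝ))).exists
  refine ⟨(1 - b) * |x| + b * |y|, ?_, ht1.trans (lt_of_lt_of_le (EReal.coe_lt_coe_iff.2 hb1)
    (SC_combo h hs hr (by linarith [hb2.2]) hb2.1.le (by ring)))⟩
  nlinarith [hb2.1]

/-- A gap `φ x < ψ x` persists on an interval just inside `|x|`, since `φ` is upper semicontinuous
and `ψ` decreases in `|x|`. This fails at `0`, where a domain larger than `{0}` is needed: functions
finite only at `0` are almost everywhere equal whatever their value there. -/
theorem SC_eq_of_ae_eq {φ : ℝ → EReal} (h : ψ ∈ SC 0) (hφ : φ ∈ SC 0) (hae : φ =ᵐ[volume] ψ)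
    {y : ℝ} (hy : y ≠ 0) (hyd : ⊥ < ψ y) : ∀ x, ψ x ≤ φ x := by
  have h1 : ∀ x, x ≠ 0 → ψ x ≤ φ x := by
    intro x hx
    by_contra hlt
    obtain ⟨t, ht1, ht2⟩ := exists_between (not_le.1 hlt)
    have hn : ∀ᶠ z in 𝓝 |x|, φ z < t := hφ.1.closed |x| t (by simpa only [SC_abs hφ] using ht1)
    obtain ⟨d, hd, hd2⟩ := Metric.eventually_nhds_iff.1 hn
    have hx' : 0 < |x| := abs_pos.2 hx
    set l := max 0 (|x| - d)
    have hl : l < |x| := max_lt hx' (by linarith)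
    have hsub : Set.Ioo l |x| ⊆ {z | φ z ≠ ψ z} := by
      intro z hz
      have hz0 : 0 < z := (le_max_left _ _).trans_lt hz.1
      have hz1 : |x| - d < z := (le_max_right _ _).trans_lt hz.1
      have a1 : φ z < t := hd2 (by rw [Real.dist_eq, abs_lt]; constructor <;> linarith [hz.2])
      have a2 : ψ x ≤ ψ z := SC_anti h (by rw [abs_of_pos hz0]; exact hz.2.le)
      exact (a1.trans (ht2.trans_le a2)).ne
    have := measure_mono_null hsub hae
    rw [Real.volume_Ioo, ENNReal.ofReal_eq_zero] at this
    linarith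
  intro x
  rcases eq_or_ne x 0 with rfl | hx
  · by_contra hlt
    obtain ⟨z, hz, hz2⟩ := SC_exists_gt h (x := 0) (y := y) (by simpa using hy) hyd
      (not_le.1 hlt)
    rw [abs_zero] at hz
    exact absurd ((h1 z hz.ne').trans (SC_le_zero hφ z)) (not_le.2 hz2)
  · exact h1 x hx

theorem coe_mem_SC {f : ℝ → ℝ} (hf : ConcaveOn ℝ Set.univ f) (hc : Continuous f)
    (he : ∀ x, f (-x) = f x) : (fun x => (f x : EReal)) ∈ SC 0 := by
  refine mem_SC_zero ?_ (continuous_coe_real_ereal.comp hc).upperSemicontinuous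
    (fun x => EReal.coe_lt_top _) (EReal.bot_lt_coe _) fun x => by rw [he]
  have := hf.convex_hypograph
  simpa using this

theorem sub_coe_mem_SC (h : ψ ∈ SC 0) (c : ℝ) : (fun x => ψ x - (c : EReal)) ∈ SC 0 := by
  have hsub : ∀ (s : ℝ) (y : EReal), (s : EReal) ≤ y - c ↔ ((s + c : ℝ) : EReal) ≤ y := by
    intro s y
    induction y with
    | bot => simp
    | coe r => rw [← EReal.coe_sub, EReal.coe_le_coe_iff, EReal.coe_le_coe_iff, le_sub_iff_add_le]
    | top => simp
  refine mem_SC_zero ?_ ?_ ?_ ?_ fun x => by rw [SC_even h]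
  · rintro ⟨x, s⟩ hs ⟨y, t⟩ ht a b ha hb hab
    change (s : EReal) ≤ ψ x - c at hs
    change (t : EReal) ≤ ψ y - c at ht
    change ((a * s + b * t : ℝ) : EReal) ≤ ψ (a * x + b * y) - c
    rw [hsub] at hs ht ⊢
    have := SC_combo h hs ht ha hb hab
    have e : a * (s + c) + b * (t + c) = a * s + b * t + c := by
      linear_combination c * hab
    rwa [e] at this
  · intro x y hy
    have hc : Continuous fun z : EReal => z - (c : EReal) := by
      refine continuous_iff_continuousAt.2 fun z => ?_
      simp only [sub_eq_add_neg, ← EReal.coe_neg]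
      exact ContinuousAt.comp (f := fun z : EReal => (z, ((-c : ℝ) : EReal)))
        (EReal.continuousAt_add (p := (z, ((-c : ℝ) : EReal))) (by simp) (by simp)) (by fun_prop)
    exact (hc.comp_upperSemicontinuous h.1.closed
      fun a b hab => EReal.sub_le_sub hab le_rfl) x y hy
  · intro x
    rcases EReal_cases_of_lt_top (h.1.lt_top x) with e | ⟨r, e⟩ <;> rw [e]
    · simp
    · exact EReal.coe_lt_top (r - c)
  · obtain ⟨M, hM⟩ := SC_zero_real h
    rw [hM]
    exact EReal.bot_lt_coe (M - c)

/-- Describes the hypograph of the midpoint by real points of the two hypographs, so that concavity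
can be checked without arithmetic involving `⊥`. -/
theorem coe_le_midpoint_iff {u v : EReal} (hu : u < ⊤) (hv : v < ⊤) (s : ℝ) :
    (s : EReal) ≤ ((1 / 2 : ℝ) : EReal) * (u + v) ↔
      ∃ a b : ℝ, (a : EReal) ≤ u ∧ (b : EReal) ≤ v ∧ s = (a + b) / 2 := by
  constructor
  · intro h
    rcases EReal_cases_of_lt_top hu with rfl | ⟨a, rfl⟩
    · rw [EReal.bot_add, EReal.coe_mul_bot_of_pos (by norm_num)] at h
      exact absurd h (by simp)
    rcases EReal_cases_of_lt_top hv with rfl | ⟨b, rfl⟩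
    · rw [EReal.add_bot, EReal.coe_mul_bot_of_pos (by norm_num)] at h
      exact absurd h (by simp)
    rw [← EReal.coe_add, ← EReal.coe_mul, EReal.coe_le_coe_iff] at h
    exact ⟨a, 2 * s - a, le_rfl, EReal.coe_le_coe_iff.2 (by linarith), by ring⟩
  · rintro ⟨a, b, ha, hb, rfl⟩
    have : ((a + b : ℝ) : EReal) ≤ u + v := by rw [EReal.coe_add]; exact add_le_add ha hb
    refine le_trans ?_ (mul_le_mul_of_nonneg_left this (EReal.coe_nonneg.2 (by norm_num)))
    rw [← EReal.coe_mul]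
    exact (EReal.coe_le_coe_iff.2 (by linarith))

theorem midpoint_mem_SC {φ : ℝ → EReal} (h : ψ ∈ SC 0) (hφ : φ ∈ SC 0) :
    (fun x => ((1 / 2 : ℝ) : EReal) * (ψ x + φ x)) ∈ SC 0 := by
  refine mem_SC_zero ?_ ?_ ?_ ?_ fun x => by rw [SC_even h, SC_even hφ]
  · rintro ⟨x, s⟩ hs ⟨y, t⟩ ht a b ha hb hab
    obtain ⟨s1, s2, hs1, hs2, es⟩ := (coe_le_midpoint_iff (h.1.lt_top x) (hφ.1.lt_top x) _).1 hs
    obtain ⟨t1, t2, ht1, ht2, et⟩ := (coe_le_midpoint_iff (h.1.lt_top y) (hφ.1.lt_top y) _).1 ht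
    refine (coe_le_midpoint_iff (h.1.lt_top _) (hφ.1.lt_top _) _).2
      ⟨a * s1 + b * t1, a * s2 + b * t2, SC_combo h hs1 ht1 ha hb hab,
        SC_combo hφ hs2 ht2 ha hb hab, ?_⟩
    simp only at es et
    simp only [Prod.smul_mk, Prod.mk_add_mk, smul_eq_mul, es, et]
    ring
  · have hadd : UpperSemicontinuous fun x => ψ x + φ x :=
      h.1.closed.add' hφ.1.closed fun x =>
        EReal.continuousAt_add (Or.inl (h.1.lt_top x).ne) (Or.inr (hφ.1.lt_top x).ne)
    have hc : Continuous fun z : EReal => ((1 / 2 : ℝ) : EReal) * z :=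
      continuous_iff_continuousAt.2 fun z =>
        EReal.Tendsto.const_mul tendsto_id (Or.inl (EReal.coe_ne_bot _)) (Or.inl (EReal.coe_ne_top _))
    exact hc.comp_upperSemicontinuous hadd fun a b hab =>
      mul_le_mul_of_nonneg_left hab (EReal.coe_nonneg.2 (by norm_num))
  · intro x
    rcases EReal_cases_of_lt_top (h.1.lt_top x) with e | ⟨r, e⟩ <;> rw [e]
    · rw [EReal.bot_add, EReal.coe_mul_bot_of_pos (by norm_num)]; simp
    rcases EReal_cases_of_lt_top (hφ.1.lt_top x) with e | ⟨s, e⟩ <;> rw [e]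
    · rw [EReal.add_bot, EReal.coe_mul_bot_of_pos (by norm_num)]; simp
    exact EReal.coe_lt_top ((1 / 2) * (r + s))
  · obtain ⟨M, hM⟩ := SC_zero_real h
    obtain ⟨N, hN⟩ := SC_zero_real hφ
    rw [hM, hN]
    exact EReal.bot_lt_coe ((1 / 2) * (M + N))

end

/-! ### Lipschitz majorants and Helly selection -/

section

variable {ψ : ℝ → EReal}

/-- The smallest `k`-Lipschitz majorant of `ψ`. -/
noncomputable def supConv (ψ : ℝ → EReal) (k x : ℝ) : ℝ :=
  sSup {s | ∃ y r : ℝ, (r : EReal) ≤ ψ y ∧ s = r - k * |x - y|}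

theorem le_supConv (h : ψ ∈ SC 0) {k : ℝ} (hk : 0 ≤ k) (x : ℝ) {y r : ℝ} (hr : (r : EReal) ≤ ψ y) :
    r - k * |x - y| ≤ supConv ψ k x := by
  obtain ⟨M, hM⟩ := SC_zero_real h
  refine le_csSup ⟨M, ?_⟩ ⟨y, r, hr, rfl⟩
  rintro _ ⟨y, r, hr, rfl⟩
  have : r ≤ M := by
    have := hr.trans (SC_le_zero h y)
    rw [hM] at this
    exact_mod_cast this
  have : 0 ≤ k * |x - y| := by positivity
  linarith

theorem supConv_le (h : ψ ∈ SC 0) {k x B : ℝ}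
    (hB : ∀ y r : ℝ, (r : EReal) ≤ ψ y → r - k * |x - y| ≤ B) : supConv ψ k x ≤ B := by
  obtain ⟨M, hM⟩ := SC_zero_real h
  refine csSup_le ⟨_, 0, M, hM.ge, rfl⟩ ?_
  rintro _ ⟨y, r, hr, rfl⟩
  exact hB y r hr

theorem exists_lt_of_lt_supConv (h : ψ ∈ SC 0) {k x t : ℝ} (ht : t < supConv ψ k x) :
    ∃ y r : ℝ, (r : EReal) ≤ ψ y ∧ t < r - k * |x - y| := by
  by_contra! hcon
  exact absurd (supConv_le h hcon) (not_le.2 ht)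

theorem le_coe_supConv (h : ψ ∈ SC 0) {k : ℝ} (hk : 0 ≤ k) (x : ℝ) : ψ x ≤ supConv ψ k x := by
  rcases EReal_cases_of_lt_top (h.1.lt_top x) with e | ⟨r, e⟩
  · rw [e]; exact bot_le
  · have := le_supConv h hk x e.ge
    rw [e, EReal.coe_le_coe_iff]
    simpa using this

theorem supConv_le_add (h : ψ ∈ SC 0) {k : ℝ} (hk : 0 ≤ k) (x z : ℝ) :
    supConv ψ k x ≤ supConv ψ k z + k * |x - z| := by
  refine supConv_le h fun y r hr => ?_
  have h1 := le_supConv h hk z hr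
  have h2 : |z - y| ≤ |x - z| + |x - y| := by
    rw [abs_sub_comm x z]; exact abs_sub_le z x y
  have := mul_le_mul_of_nonneg_left h2 hk
  linarith

theorem abs_supConv_sub_le (h : ψ ∈ SC 0) {k : ℝ} (hk : 0 ≤ k) (x z : ℝ) :
    |supConv ψ k x - supConv ψ k z| ≤ k * |x - z| := by
  have h1 := supConv_le_add h hk x z
  have h2 := supConv_le_add h hk z x
  rw [abs_sub_comm z x] at h2
  exact abs_sub_le_iff.2 ⟨by linarith, by linarith⟩

theorem continuous_supConv (h : ψ ∈ SC 0) {k : ℝ} (hk : 0 ≤ k) : Continuous (supConv ψ k) := by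
  refine (LipschitzWith.of_dist_le_mul (K := ⟨k, hk⟩) fun x z => ?_).continuous
  rw [Real.dist_eq, Real.dist_eq]
  exact abs_supConv_sub_le h hk x z

theorem supConv_mem_SC (h : ψ ∈ SC 0) {k : ℝ} (hk : 0 ≤ k) :
    (fun x => (supConv ψ k x : EReal)) ∈ SC 0 := by
  refine coe_mem_SC ⟨convex_univ, ?_⟩ (continuous_supConv h hk) ?_
  · intro x _ z _ a b ha hb hab
    simp only [smul_eq_mul]
    refine le_of_forall_pos_le_add fun ε hε => ?_
    obtain ⟨y1, r1, hr1, h1⟩ := exists_lt_of_lt_supConv h (sub_lt_self (supConv ψ k x) hε)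
    obtain ⟨y2, r2, hr2, h2⟩ := exists_lt_of_lt_supConv h (sub_lt_self (supConv ψ k z) hε)
    have h3 := le_supConv h hk (a * x + b * z) (SC_combo h hr1 hr2 ha hb hab)
    have h4 : |a * x + b * z - (a * y1 + b * y2)| ≤ a * |x - y1| + b * |z - y2| := by
      have e : a * x + b * z - (a * y1 + b * y2) = a * (x - y1) + b * (z - y2) := by ring
      rw [e]
      refine (abs_add_le _ _).trans ?_
      rw [abs_mul, abs_mul, abs_of_nonneg ha, abs_of_nonneg hb]
    have h5 := mul_le_mul_of_nonneg_left h4 hk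
    have h6 := mul_le_mul_of_nonneg_left h1.le ha
    have h7 := mul_le_mul_of_nonneg_left h2.le hb
    have h8 : a * ε + b * ε = ε := by rw [← add_mul, hab, one_mul]
    linarith
  · have : ∀ x, supConv ψ k (-x) ≤ supConv ψ k x := by
      intro x
      refine supConv_le h fun y r hr => ?_
      have := le_supConv h hk x (y := -y) (r := r) (by rwa [SC_even h])
      rwa [← abs_neg (-x - y), show -(-x - y) = x - -y by ring]
    intro x
    refine le_antisymm (this x) ?_
    simpa using this (-x)

/-- The envelope `A - b |x|` is itself `b`-Lipschitz, hence dominates the smallest `k`-Lipschitz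
majorant once `b ≤ k`. -/
theorem supConv_le_of_le (h : ψ ∈ SC 0) {A b k : ℝ} (hb : 0 ≤ b) (hbk : b ≤ k)
    (hψ : ∀ x, ψ x ≤ ((A - b * |x| : ℝ) : EReal)) (x : ℝ) : supConv ψ k x ≤ A - b * |x| := by
  refine supConv_le h fun y r hr => ?_
  have h1 : r ≤ A - b * |y| := by exact_mod_cast hr.trans (hψ y)
  have h2 : |x| - |y| ≤ |x - y| := abs_sub_abs_le_abs_sub x y
  have h3 := mul_le_mul_of_nonneg_left h2 hb
  have h4 := mul_le_mul_of_nonneg_right hbk (abs_nonneg (x - y))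
  linarith

/-- Near `x`, upper semicontinuity keeps `ψ` below `s`; at distance `d` or more, the penalty is at
least `k * d ≥ M - s`. -/
theorem tendsto_supConv (h : ψ ∈ SC 0) (x : ℝ) :
    Tendsto (fun k : ℕ => (supConv ψ k x : EReal)) atTop (𝓝 (ψ x)) := by
  rw [tendsto_order]
  refine ⟨fun t ht => Eventually.of_forall fun k =>
    ht.trans_le (le_coe_supConv h (Nat.cast_nonneg k) x), fun t ht => ?_⟩
  obtain ⟨s, hs1, hs2⟩ := EReal.lt_iff_exists_real_btwn.1 ht
  obtain ⟨M, hM⟩ := SC_zero_real h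
  obtain ⟨d, hd, hd2⟩ := Metric.eventually_nhds_iff.1 (h.1.closed x s hs1)
  filter_upwards [(tendsto_natCast_atTop_atTop (R := ℝ)).eventually_ge_atTop ((M - s) / d)]
    with k hk
  rw [div_le_iff₀ hd] at hk
  refine lt_of_le_of_lt (EReal.coe_le_coe_iff.2 (supConv_le h fun y r hr => ?_)) hs2
  have hk0 : (0 : ℝ) ≤ k := Nat.cast_nonneg k
  rcases lt_or_ge |x - y| d with hy | hy
  · have h1 := hr.trans_lt (hd2 (y := y) (by rw [Real.dist_eq, abs_sub_comm]; exact hy))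
    have h2 : r < s := by exact_mod_cast h1
    have : 0 ≤ (k : ℝ) * |x - y| := by positivity
    linarith
  · have h1 := hr.trans (SC_le_zero h y)
    rw [hM] at h1
    have h2 : r ≤ M := by exact_mod_cast h1
    have := mul_le_mul_of_nonneg_left hy hk0
    linarith

theorem exists_mem_dom_of_mem_interior {x : ℝ} (hx : x ∈ interior (dom ψ)) :
    ∃ y, |x| < |y| ∧ ⊥ < ψ y := by
  obtain ⟨d, hd, hb⟩ := Metric.mem_nhds_iff.1 (mem_interior_iff_mem_nhds.1 hx)
  rcases le_total 0 x with h | h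
  · refine ⟨x + d / 2, ?_, hb ?_⟩
    · rw [abs_of_nonneg h, abs_of_nonneg (by linarith)]; linarith
    · rw [Metric.mem_ball, Real.dist_eq, add_sub_cancel_left, abs_of_pos (by linarith)]; linarith
  · refine ⟨x - d / 2, ?_, hb ?_⟩
    · rw [abs_of_nonpos h, abs_of_nonpos (by linarith)]; linarith
    · rw [Metric.mem_ball, Real.dist_eq, sub_sub_cancel_left, abs_neg, abs_of_pos (by linarith)]
      linarith

/-- Helly selection for functions monotone in `|x|`. The upper estimate holds uniformly near each
point, because it will be used at moving arguments; the lower one is available only in the interior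
of the domain. -/
theorem SC_seq_compact {ψ : ℕ → ℝ → EReal} (hψ : ∀ n, ψ n ∈ SC 0) {c C : ℝ}
    (hc : ∀ n, (c : EReal) ≤ ψ n 0) (hC : ∀ n, ψ n 0 ≤ C) :
    ∃ φ : ℕ → ℕ, StrictMono φ ∧ ∃ χ ∈ SC 0, (∀ x, χ x ≤ C) ∧
      (∀ x t, χ x < t → ∃ d > 0, ∀ᶠ n in atTop, ∀ y, |y - x| < d → ψ (φ n) y < t) ∧
      (∀ x ∈ interior (dom χ), ∀ t < χ x, ∀ᶠ n in atTop, t < ψ (φ n) x) := by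
  -- Compactness of the product of copies of `EReal` over `ℚ`. Negative rationals are clipped to
  -- `0`, so that even `|x| = 0` has sample points strictly below it in the infimum defining `χ`.
  obtain ⟨κ, -, φ, hφ, hlim⟩ := isCompact_univ.tendsto_subseq
    (x := fun n => fun q : ℚ => ψ n (max (q : ℝ) 0)) fun n => Set.mem_univ _
  have hl : ∀ q : ℚ, Tendsto (fun n => ψ (φ n) (max (q : ℝ) 0)) atTop (𝓝 (κ q)) :=
    fun q => (tendsto_pi_nhds.1 hlim q)
  let χ : ℝ → EReal := fun x => ⨅ q : {q : ℚ // (q : ℝ) < |x|}, κ q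
  have χle : ∀ x (q : ℚ), (q : ℝ) < |x| → χ x ≤ κ q := fun x q hq =>
    iInf_le (fun q : {q : ℚ // (q : ℝ) < |x|} => κ q) ⟨q, hq⟩
  have χlt : ∀ x t, χ x < t → ∃ q : ℚ, (q : ℝ) < |x| ∧ κ q < t := by
    intro x t h
    obtain ⟨q, hq⟩ := iInf_lt_iff.1 h
    exact ⟨q, q.2, hq⟩
  have hup : ∀ x t, χ x < t → ∃ d > 0, ∀ᶠ n in atTop, ∀ y, |y - x| < d → ψ (φ n) y < t := by
    intro x t h
    obtain ⟨q, hq, hqt⟩ := χlt x t h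
    refine ⟨|x| - q, sub_pos.2 hq, ?_⟩
    filter_upwards [(hl q).eventually (gt_mem_nhds hqt)] with n hn y hy
    refine lt_of_le_of_lt (SC_anti (hψ _) ?_) hn
    rw [abs_of_nonneg (le_max_right _ _)]
    refine max_le ?_ (abs_nonneg y)
    have := abs_sub_abs_le_abs_sub x y
    rw [abs_sub_comm] at this
    linarith
  have hconc : Convex ℝ {p : ℝ × ℝ | (p.2 : EReal) ≤ χ p.1} := by
    rw [convex_iff_forall_pos]
    rintro ⟨x, s⟩ hs ⟨y, t⟩ ht a b ha hb hab
    change (s : EReal) ≤ χ x at hs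
    change (t : EReal) ≤ χ y at ht
    change ((a * s + b * t : ℝ) : EReal) ≤ χ (a * x + b * y)
    refine le_iInf ?_
    rintro ⟨q, hq⟩
    have hq' : (q : ℝ) < a * |x| + b * |y| := by
      refine hq.trans_le ((abs_add_le _ _).trans_eq ?_)
      rw [abs_mul, abs_mul, abs_of_pos ha, abs_of_pos hb]
    -- Sample radii within `d` of `|x|` and `|y|` have a convex combination still at least `q`;
    -- concavity of each `ψ (φ n)` and monotonicity in the radius then bound its value at `q` from
    -- below.
    set d := a * |x| + b * |y| - q with hd
    have hd0 : 0 < d := sub_pos.2 hq'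
    obtain ⟨q1, hq1, hq1'⟩ := exists_rat_btwn (show |x| - d < |x| by linarith)
    obtain ⟨q2, hq2, hq2'⟩ := exists_rat_btwn (show |y| - d < |y| by linarith)
    have hlow : (q : ℝ) ≤ a * max (q1 : ℝ) 0 + b * max (q2 : ℝ) 0 := by
      have h1 := mul_le_mul_of_nonneg_left (hq1.le.trans (le_max_left (q1 : ℝ) 0)) ha.le
      have h2 := mul_le_mul_of_nonneg_left (hq2.le.trans (le_max_left (q2 : ℝ) 0)) hb.le
      have h3 : a * d + b * d = d := by rw [← add_mul, hab, one_mul]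
      linarith
    refine le_of_forall_lt fun u hu => ?_
    obtain ⟨u', hu1, hu2⟩ := EReal.lt_iff_exists_real_btwn.1 hu
    set ε := (a * s + b * t) - u' with hε
    have hε0 : 0 < ε := sub_pos.2 (by exact_mod_cast hu2)
    have e1 : ((s - ε : ℝ) : EReal) < κ q1 :=
      (EReal.coe_lt_coe_iff.2 (by linarith)).trans_le (hs.trans (χle x q1 hq1'))
    have e2 : ((t - ε : ℝ) : EReal) < κ q2 :=
      (EReal.coe_lt_coe_iff.2 (by linarith)).trans_le (ht.trans (χle y q2 hq2'))
    refine hu1.trans_le (ge_of_tendsto (hl q) ?_)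
    filter_upwards [(hl q1).eventually (lt_mem_nhds e1), (hl q2).eventually (lt_mem_nhds e2)]
      with n h1 h2
    have h3 := SC_combo (hψ (φ n)) h1.le h2.le ha.le hb.le hab
    have h4 : a * (s - ε) + b * (t - ε) = u' := by
      have : a * ε + b * ε = ε := by rw [← add_mul, hab, one_mul]
      linarith
    rw [h4] at h3
    refine h3.trans (SC_anti (hψ _) ?_)
    have hm1 := mul_nonneg ha.le (le_max_right (q1 : ℝ) 0)
    have hm2 := mul_nonneg hb.le (le_max_right (q2 : ℝ) 0)
    rw [abs_of_nonneg (le_max_right _ _), abs_of_nonneg (add_nonneg hm1 hm2)]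
    exact max_le hlow (add_nonneg hm1 hm2)
  have κneg : ∀ q : ℚ, (q : ℝ) < 0 → Tendsto (fun n => ψ (φ n) 0) atTop (𝓝 (κ q)) := by
    intro q hq
    have := hl q
    rwa [max_eq_right hq.le] at this
  have hχC : ∀ x, χ x ≤ C := by
    intro x
    have h1 : ((-1 : ℚ) : ℝ) < 0 := by norm_num
    exact (χle x (-1) (h1.trans_le (abs_nonneg x))).trans
      (le_of_tendsto (κneg _ h1) (Eventually.of_forall fun n => hC _))
  have hmem : χ ∈ SC 0 := by
    refine mem_SC_zero hconc ?_ ?_ ?_ ?_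
    · intro x t ht
      obtain ⟨q, hq, hqt⟩ := χlt x t ht
      filter_upwards [continuous_abs.continuousAt.eventually (lt_mem_nhds hq)] with y hy
      exact (χle y q hy).trans_lt hqt
    · exact fun x => (hχC x).trans_lt (EReal.coe_lt_top C)
    · refine (EReal.bot_lt_coe c).trans_le (le_iInf ?_)
      rintro ⟨q, hq⟩
      rw [abs_zero] at hq
      exact ge_of_tendsto (κneg q hq) (Eventually.of_forall fun n => hc _)
    · intro x
      change (⨅ q : {q : ℚ // (q : ℝ) < |x|}, κ q) = ⨅ q : {q : ℚ // (q : ℝ) < |-x|}, κ q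
      rw [abs_neg]
  refine ⟨φ, hφ, χ, hmem, hχC, hup, fun x hx t ht => ?_⟩
  obtain ⟨y, hy, hyd⟩ := exists_mem_dom_of_mem_interior hx
  obtain ⟨z, hz, htz⟩ := SC_exists_gt hmem hy hyd ht
  obtain ⟨q, hq1, hq2⟩ := exists_rat_btwn hz
  have h1 : t < κ q := htz.trans_le (χle z q (hq2.trans_le (le_abs_self z)))
  filter_upwards [(hl q).eventually (lt_mem_nhds h1)] with n hn
  refine hn.trans_le (SC_anti (hψ _) ?_)
  rw [abs_of_nonneg (le_max_right (q : ℝ) 0)]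
  exact hq1.le.trans (le_max_left _ _)

end

/-! ### Lipschitz test functions and a priori bounds -/

theorem integrable_of_lipschitz {G : Measure ℝ} [IsProbabilityMeasure G]
    (hG : ∫⁻ x, ENNReal.ofReal |x| ∂G < ∞) {f : ℝ → ℝ} {k : ℝ} (hk : 0 ≤ k)
    (hf : ∀ x y, |f x - f y| ≤ k * |x - y|) : Integrable f G := by
  have hid : Integrable (fun x : ℝ => x) G := by
    refine ⟨measurable_id.aestronglyMeasurable, ?_⟩
    rw [hasFiniteIntegral_iff_norm]
    exact hG
  have hc : Continuous f := by
    refine (LipschitzWith.of_dist_le_mul (K := ⟨k, hk⟩) fun x z => ?_).continuous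
    rw [Real.dist_eq, Real.dist_eq]
    exact hf x z
  refine Integrable.mono' ((hid.norm.const_mul k).add (integrable_const |f 0|))
    hc.aestronglyMeasurable (Eventually.of_forall fun x => ?_)
  have h1 := hf x 0
  rw [sub_zero] at h1
  have h2 := abs_sub_abs_le_abs_sub (f x) (f 0)
  simp only [Real.norm_eq_abs, Pi.add_apply]
  linarith

/-- The easy half of Kantorovich–Rubinstein duality, through the quantile coupling. -/
theorem abs_integral_sub_le {F G : Measure ℝ} [IsProbabilityMeasure F] [IsProbabilityMeasure G]
    (hF : ∫⁻ x, ENNReal.ofReal |x| ∂F < ∞) (hG : ∫⁻ x, ENNReal.ofReal |x| ∂G < ∞)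
    {f : ℝ → ℝ} {k : ℝ} (hk : 0 ≤ k) (hf : ∀ x y, |f x - f y| ≤ k * |x - y|) {ε : ℝ} (hε : 0 ≤ ε)
    (hd : dW F G ≤ ENNReal.ofReal ε) : |∫ x, f x ∂F - ∫ x, f x ∂G| ≤ k * ε := by
  have tr : ∀ (P : Measure ℝ) [IsProbabilityMeasure P], (∫⁻ x, ENNReal.ofReal |x| ∂P < ∞) →
      Integrable (fun u => f (quantile P u)) unif ∧
        ∫ x, f x ∂P = ∫ u, f (quantile P u) ∂unif := by
    intro P _ hP
    have h1 := integrable_of_lipschitz hP hk hf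
    have hm := (measurable_quantile P).aemeasurable (μ := unif)
    rw [← map_quantile P] at h1
    refine ⟨(integrable_map_measure h1.1 hm).1 h1, ?_⟩
    rw [← integral_map hm h1.1, map_quantile P]
  obtain ⟨i1, e1⟩ := tr F hF
  obtain ⟨i2, e2⟩ := tr G hG
  rw [e1, e2, ← integral_sub i1 i2, ← Real.norm_eq_abs]
  have h3 : ∫⁻ u, ENNReal.ofReal (k * |quantile F u - quantile G u|) ∂unif ≤
      ENNReal.ofReal (k * ε) := by
    simp_rw [ENNReal.ofReal_mul hk]
    rw [lintegral_const_mul]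
    · exact mul_le_mul_right ((lintegral_quantile_sub_le F G).trans hd) _
    · exact (((measurable_quantile F).sub (measurable_quantile G)).abs).ennreal_ofReal
  refine (norm_integral_le_lintegral_norm _).trans
    (ENNReal.toReal_le_of_le_ofReal (mul_nonneg hk hε) (le_trans ?_ h3))
  exact lintegral_mono fun u => ENNReal.ofReal_le_ofReal (hf _ _)

theorem abs_sub_lipschitz (θ x y : ℝ) : abs (|x - θ| - |y - θ|) ≤ 1 * |x - y| := by
  rw [one_mul]
  refine (abs_abs_sub_abs_le_abs_sub _ _).trans_eq ?_
  congr 1; ring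

theorem integrable_abs_sub {G : Measure ℝ} [IsProbabilityMeasure G]
    (hG : ∫⁻ x, ENNReal.ofReal |x| ∂G < ∞) (θ : ℝ) : Integrable (fun x => |x - θ|) G :=
  integrable_of_lipschitz hG zero_le_one (abs_sub_lipschitz θ)

theorem eq_dirac_of_ae_eq {F : Measure ℝ} [IsProbabilityMeasure F] {a : ℝ}
    (h : ∀ᵐ y ∂F, y = a) : F = Measure.dirac a := by
  have h1 : F.map (fun y => y) = F.map (fun _ => a) := Measure.map_congr h
  have h2 : F.map (fun y => y) = F := Measure.map_id
  rwa [h2, Measure.map_const, measure_univ, one_smul] at h1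

/-- For independent `X`, `Y` with law `F`, the triangle inequality gives `E|X - Y| ≤ 2 E|X - θ|` for
every `θ`, and the left side is nonzero unless `F` is a point mass. -/
theorem exists_lower_bound_abs_deviation {F : Measure ℝ} [IsProbabilityMeasure F]
    (hA : ConditionA F) : ∃ δ > 0, ∀ θ, δ ≤ ∫ x, |x - θ| ∂F := by
  set I : ℝ≥0∞ := ∫⁻ x, ∫⁻ y, ENNReal.ofReal |x - y| ∂F ∂F with hI
  have hm : Measurable fun p : ℝ × ℝ => ENNReal.ofReal |p.1 - p.2| :=
    (measurable_fst.sub measurable_snd).abs.ennreal_ofReal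
  have hI0 : I ≠ 0 := by
    intro h0
    rw [hI, lintegral_eq_zero_iff hm.lintegral_prod_right'] at h0
    obtain ⟨x, hx⟩ := h0.exists
    simp only [Pi.zero_apply] at hx
    rw [lintegral_eq_zero_iff (f := fun y => ENNReal.ofReal |x - y|) (by fun_prop)] at hx
    have hx' : ∀ᵐ y ∂F, y = x := by
      filter_upwards [hx] with y hy
      have : |x - y| ≤ 0 := ENNReal.ofReal_eq_zero.1 hy
      have := abs_eq_zero.1 (le_antisymm this (abs_nonneg _))
      linarith
    exact hA.1 x (eq_dirac_of_ae_eq hx')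
  obtain ⟨q, hq0, hq⟩ := ENNReal.lt_iff_exists_nnreal_btwn.1
    (ENNReal.div_pos hI0 (ENNReal.ofNat_ne_top (n := 2)))
  refine ⟨q, by exact_mod_cast hq0, fun θ => ?_⟩
  have h1 : I ≤ 2 * ∫⁻ x, ENNReal.ofReal |x - θ| ∂F := by
    have hmθ : Measurable fun x : ℝ => ENNReal.ofReal |x - θ| :=
      (measurable_id.sub_const θ).abs.ennreal_ofReal
    calc I ≤ ∫⁻ x, ∫⁻ y, (ENNReal.ofReal |x - θ| + ENNReal.ofReal |y - θ|) ∂F ∂F := by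
          refine lintegral_mono fun x => lintegral_mono fun y => ?_
          rw [← ENNReal.ofReal_add (abs_nonneg _) (abs_nonneg _)]
          refine ENNReal.ofReal_le_ofReal ?_
          rw [abs_sub_comm y θ]
          exact abs_sub_le x θ y
      _ = _ := by
          simp_rw [fun x => lintegral_add_left (measurable_const (a := ENNReal.ofReal |x - θ|))
            (fun y => ENNReal.ofReal |y - θ|) (μ := F)]
          rw [lintegral_add_right _ measurable_const]
          simp [two_mul]
  have h2 : (q : ℝ≥0∞) ≤ ∫⁻ x, ENNReal.ofReal |x - θ| ∂F := by
    refine hq.le.trans (ENNReal.div_le_of_le_mul' h1)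
  rw [← ofReal_integral_eq_lintegral_ofReal (integrable_abs_sub hA.2 θ)
    (Eventually.of_forall fun x => abs_nonneg _), ← ENNReal.ofReal_coe_nnreal] at h2
  exact (ENNReal.ofReal_le_ofReal_iff (integral_nonneg fun x => abs_nonneg _)).1 h2

theorem Psi_le_of_SC {G : Measure ℝ} [IsProbabilityMeasure G]
    (hG : ∫⁻ x, ENNReal.ofReal |x| ∂G < ∞) {ψ : ℝ → EReal} (h : ψ ∈ SC 0)
    (hI : ∫⁻ x, EReal.exp (ψ x) ≤ 1) {M : ℝ} (hM : ψ 0 = M) (θ : ℝ) :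
    Psi θ ψ G ≤ ((M + 1 - 2 * Real.exp (M - 1) * ∫ x, |x - θ| ∂G : ℝ) : EReal) := by
  have hint : Integrable (fun x => M + 1 - 2 * Real.exp (M - 1) * |x - θ|) G :=
    (integrable_const (M + 1)).sub
    ((integrable_abs_sub hG θ).const_mul (2 * Real.exp (M - 1)))
  have h1 : extIntegral G (fun x => ψ (x - θ)) ≤
      ((M + 1 - 2 * Real.exp (M - 1) * ∫ x, |x - θ| ∂G : ℝ) : EReal) := by
    refine (extIntegral_mono G fun x => SC_bound h hI hM (x - θ)).trans ?_
    rw [extIntegral_coe G hint, integral_sub (integrable_const _)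
      ((integrable_abs_sub hG θ).const_mul _), integral_const_mul]
    simp
  refine le_trans ?_ h1
  unfold Psi
  refine (EReal.sub_le_sub le_rfl (EReal.coe_ennreal_nonneg _)).trans_eq ?_
  simp

/-- All three bounds come from `c ≤ M + 1 - 2 exp (M - 1) D`, with `M = ψ 0` and `D = ∫ |x - θ| dG ≥
δ`: dropping the last term bounds `M` below, the exponential bounds it above, and then `D`, hence
`|θ| ≤ D + ∫ |x| dG`, is bounded. -/
theorem exists_uniform_bound {δ : ℝ} (hδ : 0 < δ) (c K : ℝ) :
    ∃ C b R : ℝ, 0 ≤ C ∧ 0 < b ∧ ∀ (G : Measure ℝ) [IsProbabilityMeasure G],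
      ∫⁻ x, ENNReal.ofReal |x| ∂G < ∞ → (∀ θ, δ ≤ ∫ x, |x - θ| ∂G) → ∫ x, |x| ∂G ≤ K →
      ∀ (θ : ℝ) (ψ : ℝ → EReal), ψ ∈ SC 0 → ∫⁻ x, EReal.exp (ψ x) ≤ 1 → c ≤ Psi θ ψ G →
      ((c - 1 : ℝ) : EReal) ≤ ψ 0 ∧ (∀ x, ψ x ≤ ((C - b * |x| : ℝ) : EReal)) ∧ |θ| ≤ R := by
  have hb : 0 < 2 * Real.exp (c - 2) := by positivity
  refine ⟨3 + (3 + |c|) / δ, 2 * Real.exp (c - 2),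
    (3 + (3 + |c|) / δ - c) / (2 * Real.exp (c - 2)) + K, by positivity, hb, ?_⟩
  intro G _ hG hD hK θ ψ h hI hc
  obtain ⟨M, hM⟩ := SC_zero_real h
  have h1 : c ≤ M + 1 - 2 * Real.exp (M - 1) * ∫ x, |x - θ| ∂G := by
    exact_mod_cast hc.trans (Psi_le_of_SC hG h hI hM θ)
  have hD0 : 0 < ∫ x, |x - θ| ∂G := hδ.trans_le (hD θ)
  have hM1 : c - 1 ≤ M := by
    have : 0 ≤ 2 * Real.exp (M - 1) * ∫ x, |x - θ| ∂G := by positivity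
    linarith
  have hexp : Real.exp (c - 2) ≤ Real.exp (M - 1) := Real.exp_le_exp.2 (by linarith)
  -- With `t = M - 1 ≥ 1`, `exp t ≥ t² / 2` gives `δ t² ≤ t + 2 - c ≤ t (3 + |c|)`.
  have hM2 : M ≤ 2 + (3 + |c|) / δ := by
    rcases le_total (M - 1) 1 with ht | ht
    · have : 0 ≤ (3 + |c|) / δ := by positivity
      linarith
    · have h2 := Real.quadratic_le_exp_of_nonneg (by linarith : 0 ≤ M - 1)
      have h3 : δ * Real.exp (M - 1) ≤ (∫ x, |x - θ| ∂G) * Real.exp (M - 1) :=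
        mul_le_mul_of_nonneg_right (hD θ) (Real.exp_pos _).le
      have h4 : δ * ((M - 1) ^ 2 / 2) ≤ δ * Real.exp (M - 1) :=
        mul_le_mul_of_nonneg_left (by linarith) hδ.le
      have h5 := neg_abs_le c
      have h6 : (M - 1) * (δ * (M - 1)) ≤ (M - 1) * (3 + |c|) := by
        nlinarith [abs_nonneg c]
      have h7 := le_of_mul_le_mul_left h6 (by linarith)
      rw [← le_div_iff₀' hδ] at h7
      linarith
  refine ⟨by rw [hM]; exact EReal.coe_le_coe_iff.2 hM1, fun x => ?_, ?_⟩
  · refine (SC_bound h hI hM x).trans (EReal.coe_le_coe_iff.2 ?_)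
    have := mul_le_mul_of_nonneg_right hexp (abs_nonneg x)
    linarith
  · have h2 : |θ| ≤ ∫ x, |x - θ| ∂G + ∫ x, |x| ∂G := by
      have i0 : Integrable (fun x : ℝ => |x|) G := by simpa using integrable_abs_sub hG 0
      rw [← integral_add (integrable_abs_sub hG θ) i0]
      have : ∫ _x, |θ| ∂G = |θ| := by simp
      rw [← this]
      refine integral_mono (integrable_const _) ((integrable_abs_sub hG θ).add i0) fun x => ?_
      have := abs_sub_le θ x 0
      simp only [sub_zero] at this
      rwa [abs_sub_comm θ x] at this
    have h3 : ∫ x, |x - θ| ∂G ≤ (3 + (3 + |c|) / δ - c) / (2 * Real.exp (c - 2)) := by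
      rw [le_div_iff₀ hb]
      have := mul_le_mul_of_nonneg_right hexp hD0.le
      linarith
    linarith

/-- All the functions `|x - θ|` are 1-Lipschitz, so closeness in `dW` transfers the lower bound on
deviations to `Fn n` uniformly in `θ`, at the price of halving `δ`. -/
theorem eventually_uniform_bound {F : Measure ℝ} [IsProbabilityMeasure F]
    {Fn : ℕ → Measure ℝ} [∀ n, IsProbabilityMeasure (Fn n)]
    (hW : Tendsto (fun n => dW (Fn n) F) atTop (𝓝 0)) (hA : ConditionA F)
    (hAn : ∀ n, ∫⁻ x, ENNReal.ofReal |x| ∂(Fn n) < ∞) (c : ℝ) :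
    ∃ C b R : ℝ, 0 ≤ C ∧ 0 < b ∧ ∀ᶠ n in atTop,
      ∀ (θ : ℝ) (ψ : ℝ → EReal), ψ ∈ SC 0 → ∫⁻ x, EReal.exp (ψ x) ≤ 1 → c ≤ Psi θ ψ (Fn n) →
      ((c - 1 : ℝ) : EReal) ≤ ψ 0 ∧ (∀ x, ψ x ≤ ((C - b * |x| : ℝ) : EReal)) ∧ |θ| ≤ R := by
  obtain ⟨δ, hδ, hD⟩ := exists_lower_bound_abs_deviation hA
  obtain ⟨C, b, R, hC, hb, H⟩ := exists_uniform_bound (half_pos hδ) c (∫ x, |x| ∂F + δ / 2)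
  refine ⟨C, b, R, hC, hb, ?_⟩
  have hδ' : (0 : ℝ≥0∞) < ENNReal.ofReal (δ / 2) := ENNReal.ofReal_pos.2 (half_pos hδ)
  filter_upwards [hW.eventually (gt_mem_nhds hδ')] with n hn
  have key : ∀ θ, |∫ x, |x - θ| ∂(Fn n) - ∫ x, |x - θ| ∂F| ≤ 1 * (δ / 2) := fun θ =>
    abs_integral_sub_le (hAn n) hA.2 zero_le_one (abs_sub_lipschitz θ) (half_pos hδ).le hn.le
  refine H (Fn n) (hAn n) (fun θ => ?_) ?_
  · have := (abs_le.1 (key θ)).1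
    have := hD θ
    linarith
  · have := (abs_le.1 (key 0)).2
    simp only [sub_zero] at this
    linarith

/-! ### Upper semicontinuity of the criterion along subsequences -/

theorem exists_subseq_quantile_ae {F : Measure ℝ} {Fn : ℕ → Measure ℝ}
    (hW : Tendsto (fun n => dW (Fn n) F) atTop (𝓝 0)) :
    ∃ φ : ℕ → ℕ, StrictMono φ ∧
      ∀ᵐ u ∂unif, Tendsto (fun n => quantile (Fn (φ n)) u) atTop (𝓝 (quantile F u)) := by
  refine TendstoInMeasure.exists_seq_tendsto_ae (tendstoInMeasure_of_tendsto_eLpNorm one_ne_zero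
    (fun n => (measurable_quantile (Fn n)).aestronglyMeasurable)
    (measurable_quantile F).aestronglyMeasurable ?_)
  refine tendsto_of_tendsto_of_tendsto_of_le_of_le tendsto_const_nhds hW (fun _ => bot_le)
    fun n => ?_
  refine le_trans (le_of_eq ?_) (lintegral_quantile_sub_le (Fn n) F)
  rw [eLpNorm_one_eq_lintegral_enorm]
  refine lintegral_congr fun u => ?_
  rw [Pi.sub_apply, Real.enorm_eq_ofReal_abs]

theorem convex_dom {ψ : ℝ → EReal} (h : ψ ∈ SC 0) : Convex ℝ (dom ψ) := by
  intro x hx y hy a b ha hb hab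
  rcases EReal_cases_of_lt_top (h.1.lt_top x) with e | ⟨r, e⟩
  · exact absurd e hx.ne'
  rcases EReal_cases_of_lt_top (h.1.lt_top y) with e' | ⟨s, e'⟩
  · exact absurd e' hy.ne'
  exact (EReal.bot_lt_coe _).trans_le (SC_combo h e.ge e'.ge ha hb hab)

theorem ae_mem_interior_dom {ψ : ℝ → EReal} (h : ψ ∈ SC 0) :
    ∀ᵐ x, ψ x = ⊥ ∨ x ∈ interior (dom ψ) := by
  have h0 := (convex_dom h).addHaar_frontier (μ := volume)
  filter_upwards [measure_eq_zero_iff_ae_notMem.1 h0] with x hx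
  by_cases hd : x ∈ dom ψ
  · right
    by_contra hi
    exact hx ⟨subset_closure hd, hi⟩
  · left
    exact not_bot_lt_iff.1 hd

theorem continuous_toENNReal_coe_sub (a : ℝ) :
    Continuous fun z : EReal => ((a : EReal) - z).toENNReal := by
  refine EReal.continuous_toENNReal.comp (continuous_iff_continuousAt.2 fun z => ?_)
  change ContinuousAt (fun z : EReal => (a : EReal) + -z) z
  exact ContinuousAt.comp (f := fun z : EReal => ((a : EReal), -z))
    (EReal.continuousAt_add (p := ((a : EReal), -z)) (by simp) (by simp)) (by fun_prop)

theorem liminf_add_liminf_le (u v : ℕ → ℝ≥0∞) :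
    liminf u atTop + liminf v atTop ≤ liminf (fun n => u n + v n) atTop := by
  rw [liminf_eq_iSup_iInf_of_nat, liminf_eq_iSup_iInf_of_nat, liminf_eq_iSup_iInf_of_nat]
  have hmono : ∀ w : ℕ → ℝ≥0∞, Monotone fun n => ⨅ i ≥ n, w i := fun w m n hmn =>
    le_iInf₂ fun i hi => iInf₂_le i (hmn.trans hi)
  rw [ENNReal.iSup_add_iSup_of_monotone (hmono u) (hmono v)]
  exact iSup_mono fun n => le_iInf₂ fun i hi => add_le_add (iInf₂_le i hi) (iInf₂_le i hi)

/-- Fatou's lemma for each term. The data term, moved to `unif`, has converging arguments and uses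
the locally uniform upper bound `hup`; the exponential term uses `hlo` off the frontier of the
domain, which is null by convexity. -/
theorem cost_le_liminf {F : Measure ℝ} [IsProbabilityMeasure F]
    {Fn : ℕ → Measure ℝ} [∀ n, IsProbabilityMeasure (Fn n)]
    (hq : ∀ᵐ u ∂unif, Tendsto (fun n => quantile (Fn n) u) atTop (𝓝 (quantile F u)))
    {θn : ℕ → ℝ} {θ : ℝ} (hθ : Tendsto θn atTop (𝓝 θ)) {ψn : ℕ → ℝ → EReal} {ψ : ℝ → EReal}
    (hψn : ∀ n, ψn n ∈ SC 0) (hψ : ψ ∈ SC 0)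
    (hup : ∀ x t, ψ x < t → ∃ d > 0, ∀ᶠ n in atTop, ∀ y, |y - x| < d → ψn n y < t)
    (hlo : ∀ x ∈ interior (dom ψ), ∀ t < ψ x, ∀ᶠ n in atTop, t < ψn n x) (a : ℝ) :
    cost a θ ψ F ≤ liminf (fun n => cost a (θn n) (ψn n) (Fn n)) atTop := by
  have hmeas : ∀ (φ : ℝ → EReal) (η : ℝ), φ ∈ SC 0 →
      Measurable fun x => ((a : EReal) - φ (x - η)).toENNReal := fun φ η h =>
    (continuous_toENNReal_coe_sub a).measurable.comp
      ((SC_measurable h).comp (measurable_id.sub_const η))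
  refine le_trans (add_le_add ?_ ?_) (liminf_add_liminf_le _ _)
  · rw [lintegral_quantile F (hmeas ψ θ hψ)]
    simp_rw [fun n => lintegral_quantile (Fn n) (hmeas (ψn n) (θn n) (hψn n))]
    refine le_trans (lintegral_mono_ae ?_) (lintegral_liminf_le fun n =>
      (hmeas (ψn n) (θn n) (hψn n)).comp (measurable_quantile (Fn n)))
    filter_upwards [hq] with u hu
    have hx := hu.sub hθ
    set x := quantile F u - θ
    have hls : limsup (fun n => ψn n (quantile (Fn n) u - θn n)) atTop ≤ ψ x := by
      refine le_of_forall_gt fun t ht => ?_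
      obtain ⟨s, hs1, hs2⟩ := exists_between ht
      refine lt_of_le_of_lt (limsup_le_of_le (h := ?_)) hs2
      obtain ⟨d, hd, hev⟩ := hup x s hs1
      filter_upwards [hev, Metric.tendsto_nhds.1 hx d hd] with n hn hn2
      exact (hn _ hn2).le
    have hanti : Antitone fun z : EReal => ((a : EReal) - z).toENNReal := fun z w hzw =>
      EReal.toENNReal_le_toENNReal (EReal.sub_le_sub le_rfl hzw)
    exact (hanti hls).trans_eq (hanti.map_limsup_of_continuousAt _
      (continuous_toENNReal_coe_sub a).continuousAt)
  · refine le_trans (lintegral_mono_ae ?_) (lintegral_liminf_le fun n =>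
      EReal.measurable_exp.comp (SC_measurable (hψn n)))
    filter_upwards [ae_mem_interior_dom hψ] with x hx
    rcases hx with hx | hx
    · simp [hx]
    have hli : ψ x ≤ liminf (fun n => ψn n x) atTop := by
      refine le_of_forall_lt fun t ht => ?_
      obtain ⟨s, hs1, hs2⟩ := exists_between ht
      refine lt_of_lt_of_le hs1 (le_liminf_of_le (h := ?_))
      filter_upwards [hlo x hx s hs2] with n hn using hn.le
    exact (EReal.exp_monotone hli).trans_eq (EReal.exp_monotone.map_liminf_of_continuousAt _
      ENNReal.continuous_exp.continuousAt)

theorem coe_sub_lt_coe_iff (a t : ℝ) (h : t ≤ a) (x : ℝ≥0∞) :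
    (a : EReal) - (x : EReal) < t ↔ ENNReal.ofReal (a - t) < x := by
  have e : (t : EReal) = (a : EReal) - (ENNReal.ofReal (a - t) : EReal) := by
    rw [EReal.coe_ennreal_ofReal, max_eq_left (by linarith), ← EReal.coe_sub]
    congr 1; ring
  rw [e, ← not_le, coe_sub_le_coe_sub_iff, not_le]

theorem exists_subseq_limit {F : Measure ℝ} [IsProbabilityMeasure F]
    {Fn : ℕ → Measure ℝ} [∀ n, IsProbabilityMeasure (Fn n)]
    (hW : Tendsto (fun n => dW (Fn n) F) atTop (𝓝 0)) (hA : ConditionA F)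
    (hAn : ∀ n, ∫⁻ x, ENNReal.ofReal |x| ∂(Fn n) < ∞)
    {θn : ℕ → ℝ} {ψn : ℕ → ℝ → EReal} (hψn : ∀ n, ψn n ∈ SC 0)
    (hI : ∀ n, ∫⁻ x, EReal.exp (ψn n x) ≤ 1) {c : ℝ} (hc : ∀ n, c ≤ Psi (θn n) (ψn n) (Fn n)) :
    ∃ φ : ℕ → ℕ, StrictMono φ ∧ ∃ θ, ∃ ψ ∈ SC 0, Tendsto (fun n => θn (φ n)) atTop (𝓝 θ) ∧
      (∀ x t, ψ x < t → ∀ᶠ n in atTop, ψn (φ n) x < t) ∧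
      (∀ x ∈ interior (dom ψ), ∀ t < ψ x, ∀ᶠ n in atTop, t < ψn (φ n) x) ∧
      (∀ t, Psi θ ψ F < t → ∀ᶠ n in atTop, Psi (θn (φ n)) (ψn (φ n)) (Fn (φ n)) < t) := by
  obtain ⟨C, b, R, hC, hb, hev⟩ := eventually_uniform_bound hW hA hAn c
  obtain ⟨N, hN⟩ := eventually_atTop.1 hev
  have hB : ∀ n, ((c - 1 : ℝ) : EReal) ≤ ψn (n + N) 0 ∧
      (∀ x, ψn (n + N) x ≤ ((C - b * |x| : ℝ) : EReal)) ∧ |θn (n + N)| ≤ R :=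
    fun n => hN (n + N) (by omega) _ _ (hψn _) (hI _) (hc _)
  have hBC : ∀ n x, ψn (n + N) x ≤ C := fun n x => ((hB n).2.1 x).trans
    (EReal.coe_le_coe_iff.2 (by have : 0 ≤ b * |x| := by positivity
                                linarith))
  obtain ⟨φ₁, hφ₁, hq⟩ := exists_subseq_quantile_ae (F := F) (Fn := fun n => Fn (n + N))
    (hW.comp (tendsto_add_atTop_nat N))
  obtain ⟨θ, -, φ₂, hφ₂, hθ⟩ := (isCompact_Icc (a := -R) (b := R)).tendsto_subseq
    (x := fun n => θn (φ₁ n + N)) fun n => abs_le.1 (hB (φ₁ n)).2.2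
  obtain ⟨φ₃, hφ₃, ψ, hψ, hψC, hup, hlo⟩ := SC_seq_compact (ψ := fun n => ψn (φ₁ (φ₂ n) + N))
    (fun n => hψn _) (c := c - 1) (C := C) (fun n => (hB _).1) (fun n => hBC _ 0)
  -- Three nested extractions: quantiles, locations, concave functions. The shift by `N` makes the a
  -- priori bounds hold at every index.
  refine ⟨fun n => φ₁ (φ₂ (φ₃ n)) + N, fun m n hmn => by
    have := hφ₁ (hφ₂ (hφ₃ hmn)); simp only; omega, θ, ψ, hψ, hθ.comp hφ₃.tendsto_atTop, ?_, hlo, ?_⟩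
  · intro x t ht
    obtain ⟨d, hd, h⟩ := hup x t ht
    filter_upwards [h] with n hn
    exact hn x (by simpa using hd)
  · intro t ht
    obtain ⟨s, hs1, hs2⟩ := EReal.lt_iff_exists_real_btwn.1 ht
    have hcost := cost_le_liminf (F := F) (Fn := fun n => Fn (φ₁ (φ₂ (φ₃ n)) + N))
      (by filter_upwards [hq] with u hu using
            hu.comp (hφ₂.tendsto_atTop.comp hφ₃.tendsto_atTop))
      (hθ.comp hφ₃.tendsto_atTop) (fun n => hψn _) hψ hup hlo C
    rw [Psi_eq_sub_cost F (SC_measurable hψ) hC hψC] at hs1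
    have hP : ∀ n, Psi (θn (n + N)) (ψn (n + N)) (Fn (n + N)) =
        (C : EReal) - (cost C (θn (n + N)) (ψn (n + N)) (Fn (n + N)) : EReal) := fun n =>
      Psi_eq_sub_cost _ (SC_measurable (hψn _)) hC (hBC n) _
    rcases lt_or_ge C s with hCs | hCs
    · refine Eventually.of_forall fun n => ?_
      rw [hP]
      refine lt_of_le_of_lt ?_ ((EReal.coe_lt_coe_iff.2 hCs).trans hs2)
      refine (EReal.sub_le_sub le_rfl (EReal.coe_ennreal_nonneg _)).trans_eq ?_
      simp
    · rw [coe_sub_lt_coe_iff C s hCs] at hs1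
      filter_upwards [eventually_lt_of_lt_liminf (hs1.trans_le hcost)] with n hn
      rw [hP]
      exact ((coe_sub_lt_coe_iff C s hCs _).2 hn).trans hs2

/-! ### Existence of maximizers and lower semicontinuity of `L` -/

theorem SC_measurable_exp {ψ : ℝ → EReal} (h : ψ ∈ SC 0) : Measurable fun x => EReal.exp (ψ x) :=
  EReal.measurable_exp.comp (SC_measurable h)

theorem lintegral_exp_neg_mul_abs_lt_top {b : ℝ} (hb : 0 < b) (A : ℝ) :
    ∫⁻ x : ℝ, ENNReal.ofReal (Real.exp (A - b * |x|)) < ⊤ := by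
  have h1 : IntegrableOn (fun x : ℝ => Real.exp (-b * |x|)) (Set.Ioi 0) :=
    (exp_neg_integrableOn_Ioi 0 hb).congr_fun
      (fun x hx => by simp only [abs_of_pos (Set.mem_Ioi.1 hx)]) measurableSet_Ioi
  have h2 : IntegrableOn (fun x : ℝ => Real.exp (-b * |x|)) (Set.Iic 0) :=
    (integrableOn_exp_mul_Iic hb 0).congr_fun
      (fun x hx => by simp only [abs_of_nonpos (Set.mem_Iic.1 hx), neg_mul_neg]) measurableSet_Iic
  have h3 : Integrable (fun x : ℝ => Real.exp (-b * |x|)) := by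
    rw [← integrableOn_univ, ← Set.Iic_union_Ioi (a := (0 : ℝ))]
    exact h2.union h1
  have h4 := (h3.const_mul (Real.exp A)).lintegral_lt_top
  refine lt_of_le_of_lt (le_of_eq ?_) h4
  refine lintegral_congr fun x => ?_
  rw [← Real.exp_add]
  congr 2; ring

theorem Psi_coe {G : Measure ℝ} {f : ℝ → ℝ} {θ : ℝ} (hf : Integrable (fun x => f (x - θ)) G)
    (hI : ∫⁻ x, ENNReal.ofReal (Real.exp (f x)) < ⊤) :
    Psi θ (fun x => (f x : EReal)) G =
      ((∫ x, f (x - θ) ∂G - (∫⁻ x, ENNReal.ofReal (Real.exp (f x))).toReal : ℝ) : EReal) := by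
  rw [Psi, extIntegral_coe G hf, EReal.coe_sub, EReal.coe_ennreal_toReal hI.ne,
    lintegral_sub_right_eq_self (fun x => EReal.exp (f x)) θ]
  rfl

theorem bot_lt_L {F : Measure ℝ} [IsProbabilityMeasure F]
    (hF : ∫⁻ x, ENNReal.ofReal |x| ∂F < ∞) : ⊥ < L F := by
  -- A Laplace-type competitor has finite criterion as soon as the first moment is finite.
  have hmem : (fun x : ℝ => ((-|x| : ℝ) : EReal)) ∈ SC 0 := by
    refine coe_mem_SC ?_ continuous_abs.neg fun x => by rw [abs_neg]
    have := (convexOn_norm (E := ℝ) convex_univ).neg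
    exact this
  have hint : Integrable (fun x => -|x - 0|) F := (integrable_abs_sub hF 0).neg
  have h1 := lintegral_exp_neg_mul_abs_lt_top one_pos 0
  simp only [one_mul, zero_sub] at h1
  have h2 : Psi 0 (fun x : ℝ => ((-|x| : ℝ) : EReal)) F ≤ L F :=
    le_iSup_of_le 0 (le_iSup_of_le _ (le_iSup_of_le hmem le_rfl))
  rw [Psi_coe (f := fun x => -|x|) hint h1] at h2
  exact (EReal.bot_lt_coe _).trans_le h2

theorem Psi_le_L {F : Measure ℝ} {ψ : ℝ → EReal} (h : ψ ∈ SC 0) (θ : ℝ) : Psi θ ψ F ≤ L F :=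
  le_iSup_of_le θ (le_iSup_of_le ψ (le_iSup_of_le h le_rfl))

theorem IsMaximizer_iff {F : Measure ℝ} {ψ : ℝ → EReal} {θ : ℝ} :
    IsMaximizer F θ ψ ↔ ψ ∈ SC 0 ∧ Psi θ ψ F = L F := by
  constructor
  · rintro ⟨h, hm⟩
    exact ⟨h, le_antisymm (Psi_le_L h θ) (iSup_le fun θ' => iSup_le fun ψ' => iSup_le fun h' =>
      hm θ' ψ' h')⟩
  · rintro ⟨h, hm⟩
    exact ⟨h, fun θ' ψ' h' => hm ▸ Psi_le_L h' θ'⟩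

/-- Subtracting `c = log I`, where `I` is the total mass, changes the criterion by `I - 1 - c = exp
c - 1 - c > 0`. Mass below one needs no correction, since the a priori bounds only ask for mass at
most one. -/
theorem exists_Psi_lt_of_one_lt {F : Measure ℝ} [IsProbabilityMeasure F] {ψ : ℝ → EReal}
    (h : ψ ∈ SC 0) {θ : ℝ} (hP : ⊥ < Psi θ ψ F) (hI : 1 < ∫⁻ x, EReal.exp (ψ x)) :
    ∃ φ ∈ SC 0, ∫⁻ x, EReal.exp (φ x) ≤ 1 ∧ Psi θ ψ F < Psi θ φ F := by
  obtain ⟨M, hM⟩ := SC_zero_real h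
  have ha : 0 ≤ max M 0 := le_max_right _ _
  have hψa : ∀ x, ψ x ≤ (max M 0 : ℝ) := fun x => (SC_le_zero h x).trans (by
    rw [hM]; exact EReal.coe_le_coe_iff.2 (le_max_left _ _))
  set a := max M 0
  rw [Psi_eq_sub_cost F (SC_measurable h) ha hψa] at hP ⊢
  have hfin : cost a θ ψ F ≠ ⊤ := fun e => hP.ne' ((coe_sub_coe_eq_bot_iff a _).2 e)
  unfold cost at hfin
  obtain ⟨hA, hB⟩ := ENNReal.add_ne_top.1 hfin
  set I := ∫⁻ x, EReal.exp (ψ x) with hIdef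
  have hI1 : 1 < I.toReal := by
    rw [← ENNReal.toReal_one]
    exact (ENNReal.toReal_lt_toReal ENNReal.one_ne_top hB).2 hI
  set c := Real.log I.toReal with hc
  have hc0 : 0 < c := Real.log_pos hI1
  have hIc : I = ENNReal.ofReal (Real.exp c) := by
    rw [hc, Real.exp_log (by linarith), ENNReal.ofReal_toReal hB]
  have hexp : ∫⁻ x, EReal.exp (ψ x - (c : EReal)) = 1 := by
    have : ∀ x, EReal.exp (ψ x - (c : EReal)) =
        EReal.exp (ψ x) * ENNReal.ofReal (Real.exp (-c)) := fun x => by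
      rw [sub_eq_add_neg, EReal.exp_add, ← EReal.coe_neg, EReal.exp_coe]
    simp_rw [this]
    rw [lintegral_mul_const _ (SC_measurable_exp h), ← hIdef, hIc,
      ← ENNReal.ofReal_mul (Real.exp_pos _).le, ← Real.exp_add, add_neg_cancel, Real.exp_zero,
      ENNReal.ofReal_one]
  have hmem := sub_coe_mem_SC h c
  refine ⟨_, hmem, hexp.le, ?_⟩
  rw [Psi_eq_sub_cost F (SC_measurable hmem) ha fun x => ?_]
  · rw [← not_le, coe_sub_le_coe_sub_iff, not_le]
    have hshift : ∀ x, ((a : EReal) - (ψ x - (c : EReal))).toENNReal =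
        ((a : EReal) - ψ x).toENNReal + ENNReal.ofReal c := by
      intro x
      have := hψa x
      rcases EReal_cases_of_lt_top (h.1.lt_top x) with e | ⟨r, e⟩ <;> rw [e] at this ⊢
      · simp
      · have hr : r ≤ a := by exact_mod_cast this
        rw [← EReal.coe_sub, ← EReal.coe_sub, ← EReal.coe_sub]
        simp only [EReal.real_coe_toENNReal]
        rw [← ENNReal.ofReal_add (by linarith) hc0.le]
        congr 1; ring
    unfold cost
    simp_rw [hshift]
    rw [hexp, lintegral_add_right _ measurable_const, ← hIdef, hIc]
    simp only [lintegral_const, measure_univ, mul_one]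
    rw [add_assoc]
    refine ENNReal.add_lt_add_left hA ?_
    rw [← ENNReal.ofReal_one, ← ENNReal.ofReal_add hc0.le zero_le_one]
    exact (ENNReal.ofReal_lt_ofReal_iff (Real.exp_pos _)).2 (Real.add_one_lt_exp hc0.ne')
  · refine le_trans (EReal.sub_le_sub le_rfl (EReal.coe_nonneg.2 hc0.le)) ?_
    simpa using hψa x

theorem exists_normalized {F : Measure ℝ} [IsProbabilityMeasure F] {ψ : ℝ → EReal}
    (h : ψ ∈ SC 0) {θ : ℝ} (hP : ⊥ < Psi θ ψ F) :
    ∃ φ ∈ SC 0, ∫⁻ x, EReal.exp (φ x) ≤ 1 ∧ Psi θ ψ F ≤ Psi θ φ F := by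
  rcases le_or_gt (∫⁻ x, EReal.exp (ψ x)) 1 with hI | hI
  · exact ⟨ψ, h, hI, le_rfl⟩
  · obtain ⟨φ, h1, h2, h3⟩ := exists_Psi_lt_of_one_lt h hP hI
    exact ⟨φ, h1, h2, h3.le⟩

theorem lintegral_exp_le_one_of_isMaximizer {F : Measure ℝ} [IsProbabilityMeasure F]
    (hF : ∫⁻ x, ENNReal.ofReal |x| ∂F < ∞) {ψ : ℝ → EReal} {θ : ℝ} (h : IsMaximizer F θ ψ) :
    ∫⁻ x, EReal.exp (ψ x) ≤ 1 := by
  by_contra hI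
  obtain ⟨φ, h1, -, h3⟩ := exists_Psi_lt_of_one_lt h.1
    ((bot_lt_L hF).trans_eq (IsMaximizer_iff.1 h).2.symm) (not_le.1 hI)
  exact absurd (h.2 θ φ h1) (not_le.2 h3)

theorem exists_isMaximizer {F : Measure ℝ} [IsProbabilityMeasure F] (hA : ConditionA F) :
    ∃ θ ψ, IsMaximizer F θ ψ := by
  obtain ⟨v, hv, hvL, hlim⟩ := exists_seq_strictMono_tendsto' (bot_lt_L hA.2)
  have hex : ∀ n, ∃ θ : ℝ, ∃ ψ ∈ SC 0, ∫⁻ x, EReal.exp (ψ x) ≤ 1 ∧ v n ≤ Psi θ ψ F := by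
    intro n
    obtain ⟨θ, h1⟩ := lt_iSup_iff.1 (hvL n).2
    obtain ⟨ψ, h2⟩ := lt_iSup_iff.1 h1
    obtain ⟨hψ, h3⟩ := lt_iSup_iff.1 h2
    obtain ⟨φ, hφ, h4, h5⟩ := exists_normalized hψ (bot_le.trans_lt h3)
    exact ⟨θ, φ, hφ, h4, h3.le.trans h5⟩
  choose θn ψn hψn hI hP using hex
  obtain ⟨c, -, hc⟩ := EReal.lt_iff_exists_real_btwn.1 (hvL 0).1
  -- The compactness result for varying laws, applied to the constant sequence `F` and a normalized
  -- maximizing sequence.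
  obtain ⟨φ, hφ, θ, ψ, hψ, -, -, -, hlim'⟩ := exists_subseq_limit (F := F) (Fn := fun _ => F)
    (by simp [dW]) hA (fun _ => hA.2) hψn hI (c := c)
    fun n => hc.le.trans ((hv.monotone (Nat.zero_le n)).trans (hP n))
  refine ⟨θ, ψ, IsMaximizer_iff.2 ⟨hψ, le_antisymm (Psi_le_L hψ θ) ?_⟩⟩
  by_contra hlt
  obtain ⟨s, hs1, hs2⟩ := exists_between (not_le.1 hlt)
  obtain ⟨n, h1, h2⟩ := ((hlim' s hs1).and
    ((hlim.comp hφ.tendsto_atTop).eventually (lt_mem_nhds hs2))).exists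
  exact absurd ((hP (φ n)).trans h1.le) (not_le.2 h2)

/-- A near-optimal `ψ` for `F` may be `⊥` where `Fn n` has mass. Its majorant `supConv ψ k` is
Lipschitz, does not lower the integral against `F`, and for large `k` increases the exponential
integral arbitrarily little. -/
theorem eventually_lt_L {F : Measure ℝ} [IsProbabilityMeasure F]
    {Fn : ℕ → Measure ℝ} [∀ n, IsProbabilityMeasure (Fn n)]
    (hW : Tendsto (fun n => dW (Fn n) F) atTop (𝓝 0)) (hA : ConditionA F)
    (hAn : ∀ n, ∫⁻ x, ENNReal.ofReal |x| ∂(Fn n) < ∞) {t : EReal} (ht : t < L F) :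
    ∀ᶠ n in atTop, t < L (Fn n) := by
  obtain ⟨θ, h1⟩ := lt_iSup_iff.1 ht
  obtain ⟨ψ₀, h2⟩ := lt_iSup_iff.1 h1
  obtain ⟨hψ₀, h3⟩ := lt_iSup_iff.1 h2
  obtain ⟨ψ, hψ, hI, h4⟩ := exists_normalized hψ₀ (bot_le.trans_lt h3)
  obtain ⟨s, hs1, hs2⟩ := EReal.lt_iff_exists_real_btwn.1 (h3.trans_le h4)
  obtain ⟨M, hM⟩ := SC_zero_real hψ
  set b := 2 * Real.exp (M - 1) with hbdef
  have hb : 0 < b := by positivity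
  have hbd := SC_bound hψ hI hM
  have hdec : ∀ k : ℕ, b ≤ k → ∀ x, supConv ψ k x ≤ M + 1 - b * |x| :=
    fun k hk => supConv_le_of_le hψ hb.le hk hbd
  have hlimI : Tendsto (fun k : ℕ => ∫⁻ x, ENNReal.ofReal (Real.exp (supConv ψ k x))) atTop
      (𝓝 (∫⁻ x, EReal.exp (ψ x))) := by
    refine tendsto_lintegral_filter_of_dominated_convergence
      (fun x => ENNReal.ofReal (Real.exp (M + 1 - b * |x|)))
      (Eventually.of_forall fun k =>
        (Real.continuous_exp.comp (continuous_supConv hψ k.cast_nonneg)).measurable.ennreal_ofReal)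
      ?_ (lintegral_exp_neg_mul_abs_lt_top hb _).ne (Eventually.of_forall fun x => ?_)
    · filter_upwards [tendsto_natCast_atTop_atTop.eventually_ge_atTop b] with k hk
      exact Eventually.of_forall fun x =>
        ENNReal.ofReal_le_ofReal (Real.exp_le_exp.2 (hdec k hk x))
    · exact (ENNReal.continuous_exp.tendsto _).comp (tendsto_supConv hψ x)
  have hIfin : ∫⁻ x, EReal.exp (ψ x) ≠ ⊤ := (hI.trans_lt ENNReal.one_lt_top).ne
  have hlimR := (ENNReal.tendsto_toReal hIfin).comp hlimI
  have hψint : ∀ (k : ℕ) (G : Measure ℝ) [IsProbabilityMeasure G],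
      ∫⁻ x, ENNReal.ofReal |x| ∂G < ∞ → Integrable (fun x => supConv ψ k (x - θ)) G :=
    fun k G _ hG => integrable_of_lipschitz hG k.cast_nonneg fun x y => by
      simpa using abs_supConv_sub_le hψ k.cast_nonneg (x - θ) (y - θ)
  have hext : ∀ k : ℕ, extIntegral F (fun x => ψ (x - θ)) ≤
      ((∫ x, supConv ψ k (x - θ) ∂F : ℝ) : EReal) := fun k =>
    (extIntegral_mono F fun x => le_coe_supConv hψ k.cast_nonneg _).trans_eq
      (extIntegral_coe F (hψint k F hA.2))
  obtain ⟨e, he⟩ : ∃ e : ℝ, extIntegral F (fun x => ψ (x - θ)) = e := by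
    rcases EReal_cases_of_lt_top ((hext 0).trans_lt (EReal.coe_lt_top _)) with h | h
    · rw [Psi, h, EReal.bot_sub] at hs2
      exact absurd hs2 not_lt_bot
    · exact h
  have hse : s < e - (∫⁻ x, EReal.exp (ψ x)).toReal := by
    rw [Psi, he, lintegral_sub_right_eq_self (fun x => EReal.exp (ψ x)) θ,
      ← EReal.coe_ennreal_toReal hIfin, ← EReal.coe_sub] at hs2
    exact_mod_cast hs2
  obtain ⟨k, hk1, hk2⟩ := ((hlimR.eventually (gt_mem_nhds (show _ < e - s by linarith))).and
    (tendsto_natCast_atTop_atTop.eventually_ge_atTop b)).exists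
  simp only [Function.comp_apply] at hk1
  have hk0 : (0 : ℝ) < k := hb.trans_le hk2
  have hIk : ∫⁻ x, ENNReal.ofReal (Real.exp (supConv ψ k x)) < ⊤ :=
    (lintegral_mono fun x => ENNReal.ofReal_le_ofReal (Real.exp_le_exp.2 (hdec k hk2 x))).trans_lt
      (lintegral_exp_neg_mul_abs_lt_top hb _)
  set J := (∫⁻ x, ENNReal.ofReal (Real.exp (supConv ψ k x))).toReal
  -- Replacing `F` by `Fn n` changes the integral of the `k`-Lipschitz majorant by at most `k * ε`,
  -- exactly the slack above `s`.
  set ε := (e - s - J) / k with hε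
  have hε0 : 0 < ε := div_pos (by linarith) hk0
  filter_upwards [hW.eventually (gt_mem_nhds (ENNReal.ofReal_pos.2 hε0))] with n hn
  refine hs1.trans_le (le_trans ?_ (Psi_le_L (supConv_mem_SC hψ hk0.le) θ))
  rw [Psi_coe (hψint k (Fn n) (hAn n)) hIk, EReal.coe_le_coe_iff]
  have h5 := abs_integral_sub_le (hAn n) hA.2 (f := fun x => supConv ψ k (x - θ)) hk0.le
    (fun x y => by simpa using abs_supConv_sub_le hψ hk0.le (x - θ) (y - θ)) hε0.le hn.le
  have h6 : e ≤ ∫ x, supConv ψ k (x - θ) ∂F := by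
    have := hext k
    rw [he] at this
    exact_mod_cast this
  have h7 : (k : ℝ) * ε = e - s - J := by rw [hε]; field_simp
  have h8 := (abs_le.1 h5).1
  rw [h7] at h8
  linarith

/-! ### Uniqueness of the maximizer -/

theorem two_mul_exp_midpoint_le {u v : EReal} (hu : u < ⊤) (hv : v < ⊤) :
    2 * EReal.exp (((1 / 2 : ℝ) : EReal) * (u + v)) ≤ EReal.exp u + EReal.exp v ∧
      (2 * EReal.exp (((1 / 2 : ℝ) : EReal) * (u + v)) = EReal.exp u + EReal.exp v → u = v) := by
  have hbot : ((1 / 2 : ℝ) : EReal) * ⊥ = ⊥ := EReal.coe_mul_bot_of_pos (by norm_num)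
  rcases EReal_cases_of_lt_top hu with rfl | ⟨r, rfl⟩
  · rw [EReal.bot_add, hbot, EReal.exp_bot, mul_zero, zero_add]
    exact ⟨bot_le, fun h => (EReal.exp_eq_zero_iff.1 h.symm).symm⟩
  rcases EReal_cases_of_lt_top hv with rfl | ⟨s, rfl⟩
  · rw [EReal.add_bot, hbot, EReal.exp_bot, mul_zero, add_zero]
    exact ⟨bot_le, fun h => (EReal.exp_eq_zero_iff.1 h.symm)⟩
  have e1 : 2 * EReal.exp (((1 / 2 : ℝ) : EReal) * ((r : EReal) + s)) =
      ENNReal.ofReal (2 * (Real.exp (r / 2) * Real.exp (s / 2))) := by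
    rw [← EReal.coe_add, ← EReal.coe_mul, EReal.exp_coe, ENNReal.ofReal_mul (by norm_num),
      ← Real.exp_add]
    congr 2
    · simp
    · ring_nf
  have e2 : EReal.exp (r : EReal) + EReal.exp (s : EReal) =
      ENNReal.ofReal (Real.exp (r / 2) ^ 2 + Real.exp (s / 2) ^ 2) := by
    rw [EReal.exp_coe, EReal.exp_coe, ← ENNReal.ofReal_add (Real.exp_pos _).le (Real.exp_pos _).le,
      ← Real.exp_nat_mul, ← Real.exp_nat_mul]
    congr 3 <;> push_cast <;> ring
  rw [e1, e2]
  constructor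
  · refine ENNReal.ofReal_le_ofReal ?_
    nlinarith [sq_nonneg (Real.exp (r / 2) - Real.exp (s / 2))]
  · intro h
    rw [ENNReal.ofReal_eq_ofReal_iff (by positivity) (by positivity)] at h
    have h0 : (Real.exp (r / 2) - Real.exp (s / 2)) ^ 2 = 0 := by linarith
    have h1 := Real.exp_injective (sub_eq_zero.1 (pow_eq_zero_iff (two_ne_zero)|>.1 h0))
    congr 1
    linarith

/-- The midpoint `μ` averages the data terms exactly, so optimality of `ψ` and `φ` gives `∫ (exp ψ +
exp φ) ≤ ∫ 2 exp μ`. Convexity of `exp` is the pointwise reverse, and its equality case yields `ψ =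
φ` almost everywhere. -/
theorem isMaximizer_unique {F : Measure ℝ} [IsProbabilityMeasure F] (hA : ConditionA F) {θ : ℝ}
    {ψ φ : ℝ → EReal} (h : IsMaximizer F θ ψ) (h' : IsMaximizer F θ φ) : ψ = φ := by
  obtain ⟨M, hM⟩ := SC_zero_real h.1
  obtain ⟨N, hN⟩ := SC_zero_real h'.1
  set a := max (max M N) 0 with hadef
  have ha : 0 ≤ a := le_max_right _ _
  have hψa : ∀ x, ψ x ≤ (a : ℝ) := fun x => (SC_le_zero h.1 x).trans (by
    rw [hM]; exact EReal.coe_le_coe_iff.2 ((le_max_left _ _).trans (le_max_left _ _)))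
  have hφa : ∀ x, φ x ≤ (a : ℝ) := fun x => (SC_le_zero h'.1 x).trans (by
    rw [hN]; exact EReal.coe_le_coe_iff.2 ((le_max_right _ _).trans (le_max_left _ _)))
  have hbot : ((1 / 2 : ℝ) : EReal) * ⊥ = ⊥ := EReal.coe_mul_bot_of_pos (by norm_num)
  have hmid := midpoint_mem_SC h.1 h'.1
  set μ : ℝ → EReal := fun x => ((1 / 2 : ℝ) : EReal) * (ψ x + φ x) with hμ
  have hdouble : ∀ x, μ x ≤ a ∧ 2 * ((a : EReal) - μ x).toENNReal =
      ((a : EReal) - ψ x).toENNReal + ((a : EReal) - φ x).toENNReal := by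
    intro x
    have h1 := hψa x
    have h2 := hφa x
    simp only [hμ]
    rcases EReal_cases_of_lt_top (h.1.1.lt_top x) with e | ⟨r, e⟩ <;> rw [e] at h1 ⊢
    · rw [EReal.bot_add, hbot]; simp
    rcases EReal_cases_of_lt_top (h'.1.1.lt_top x) with e | ⟨s, e⟩ <;> rw [e] at h2 ⊢
    · rw [EReal.add_bot, hbot]; simp
    have h1' : r ≤ a := by exact_mod_cast h1
    have h2' : s ≤ a := by exact_mod_cast h2
    rw [← EReal.coe_add, ← EReal.coe_mul, ← EReal.coe_sub, ← EReal.coe_sub, ← EReal.coe_sub]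
    simp only [EReal.real_coe_toENNReal]
    refine ⟨EReal.coe_le_coe_iff.2 (by linarith), ?_⟩
    rw [← ENNReal.ofReal_add (by linarith) (by linarith), ← ENNReal.ofReal_ofNat 2,
      ← ENNReal.ofReal_mul (by norm_num)]
    congr 1; ring
  have c1 := h.2 θ μ hmid
  have c2 := h'.2 θ μ hmid
  have hfin : ⊥ < Psi θ ψ F := (bot_lt_L hA.2).trans_eq (IsMaximizer_iff.1 h).2.symm
  have hfin' : ⊥ < Psi θ φ F := (bot_lt_L hA.2).trans_eq (IsMaximizer_iff.1 h').2.symm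
  rw [Psi_eq_sub_cost F (SC_measurable h.1) ha hψa] at hfin
  rw [Psi_eq_sub_cost F (SC_measurable h'.1) ha hφa] at hfin'
  rw [Psi_eq_sub_cost F (SC_measurable h.1) ha hψa,
    Psi_eq_sub_cost F (SC_measurable hmid) ha fun x => (hdouble x).1, coe_sub_le_coe_sub_iff] at c1
  rw [Psi_eq_sub_cost F (SC_measurable h'.1) ha hφa,
    Psi_eq_sub_cost F (SC_measurable hmid) ha fun x => (hdouble x).1, coe_sub_le_coe_sub_iff] at c2
  have f1 : cost a θ ψ F ≠ ⊤ := fun e => hfin.ne' ((coe_sub_coe_eq_bot_iff a _).2 e)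
  have f2 : cost a θ φ F ≠ ⊤ := fun e => hfin'.ne' ((coe_sub_coe_eq_bot_iff a _).2 e)
  unfold cost at c1 c2 f1 f2
  obtain ⟨fA, fI⟩ := ENNReal.add_ne_top.1 f1
  obtain ⟨fB, fJ⟩ := ENNReal.add_ne_top.1 f2
  have hmeasA : Measurable fun x => ((a : EReal) - ψ (x - θ)).toENNReal :=
    (continuous_toENNReal_coe_sub a).measurable.comp
      ((SC_measurable h.1).comp (measurable_id.sub_const θ))
  have hAB : 2 * ∫⁻ x, ((a : EReal) - μ (x - θ)).toENNReal ∂F =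
      ∫⁻ x, ((a : EReal) - ψ (x - θ)).toENNReal ∂F +
        ∫⁻ x, ((a : EReal) - φ (x - θ)).toENNReal ∂F := by
    rw [← lintegral_add_left hmeasA, ← lintegral_const_mul' _ _ ENNReal.ofNat_ne_top]
    exact lintegral_congr fun x => (hdouble _).2
  have hE : ∫⁻ x, (EReal.exp (ψ x) + EReal.exp (φ x)) ≤ ∫⁻ x, 2 * EReal.exp (μ x) := by
    rw [lintegral_add_left (SC_measurable_exp h.1),
      lintegral_const_mul' _ _ ENNReal.ofNat_ne_top]
    have := add_le_add c1 c2
    rw [add_add_add_comm, ← two_mul, mul_add, hAB] at this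
    exact (ENNReal.add_le_add_iff_left (ENNReal.add_ne_top.2 ⟨fA, fB⟩)).1 this
  have hae : (fun x => 2 * EReal.exp (μ x)) =ᵐ[volume] fun x => EReal.exp (ψ x) + EReal.exp (φ x) := by
    refine ae_eq_of_ae_le_of_lintegral_le (Eventually.of_forall fun x =>
      (two_mul_exp_midpoint_le (h.1.1.lt_top x) (h'.1.1.lt_top x)).1) ?_ ?_ hE
    · refine ne_top_of_le_ne_top (b := ∫⁻ x, (EReal.exp (ψ x) + EReal.exp (φ x))) ?_ ?_
      · rw [lintegral_add_left (SC_measurable_exp h.1)]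
        exact ENNReal.add_ne_top.2 ⟨fI, fJ⟩
      · exact lintegral_mono fun x =>
          (two_mul_exp_midpoint_le (h.1.1.lt_top x) (h'.1.1.lt_top x)).1
    · exact ((SC_measurable_exp h.1).add
        (SC_measurable_exp h'.1)).aemeasurable
  have hae' : ψ =ᵐ[volume] φ := by
    filter_upwards [hae] with x hx
    exact (two_mul_exp_midpoint_le (h.1.1.lt_top x) (h'.1.1.lt_top x)).2 hx
  -- Passing from almost everywhere to everywhere needs a domain larger than `{0}`: with domain in
  -- `{0}`, finite cost would concentrate `F` at `θ`.
  have hdom : ∀ χ : ℝ → EReal, ∫⁻ x, ((a : EReal) - χ (x - θ)).toENNReal ∂F ≠ ⊤ →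
      χ ∈ SC 0 → ∃ y, y ≠ 0 ∧ ⊥ < χ y := by
    intro χ hχ hS
    by_contra! hcon
    refine hA.1 θ (eq_dirac_of_ae_eq ?_)
    have hm : Measurable fun x => ((a : EReal) - χ (x - θ)).toENNReal :=
      (continuous_toENNReal_coe_sub a).measurable.comp
        ((SC_measurable hS).comp (measurable_id.sub_const θ))
    filter_upwards [ae_lt_top hm hχ] with x hx
    by_contra hne
    have := le_bot_iff.1 (hcon (x - θ) (sub_ne_zero.2 hne))
    rw [this] at hx
    simp at hx
  obtain ⟨y, hy, hyd⟩ := hdom ψ fA h.1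
  obtain ⟨z, hz, hzd⟩ := hdom φ fB h'.1
  funext x
  exact le_antisymm (SC_eq_of_ae_eq h.1 h'.1 hae'.symm hy hyd x)
    (SC_eq_of_ae_eq h'.1 h.1 hae' hz hzd x)

theorem isMaximizer_iff_eq_star {F : Measure ℝ} [IsProbabilityMeasure F] (hA : ConditionA F)
    (hB : ConditionB F) (θ : ℝ) (ψ : ℝ → EReal) :
    IsMaximizer F θ ψ ↔ θ = thetaStar F ∧ ψ = psiStar F := by
  have hs : IsMaximizer F (thetaStar F) (psiStar F) := by
    obtain ⟨θ', ψ', h⟩ := exists_isMaximizer hA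
    exact Classical.epsilon_spec (p := fun q : ℝ × (ℝ → EReal) => IsMaximizer F q.1 q.2)
      ⟨(θ', ψ'), h⟩
  constructor
  · intro h
    have hθ := hB _ _ _ _ h hs
    subst hθ
    exact ⟨rfl, isMaximizer_unique hA h hs⟩
  · rintro ⟨rfl, rfl⟩
    exact hs

/-- Turns a one-sided limsup bound into a genuine limit, to which the subsequence principle applies.
-/
theorem tendsto_max_of_forall_eventually_lt {ι : Type*} {l : Filter ι} {u : ι → EReal} {a : EReal}
    (h : ∀ t, a < t → ∀ᶠ n in l, u n < t) : Tendsto (fun n => max (u n) a) l (𝓝 a) := by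
  rw [tendsto_order]
  refine ⟨fun t ht => Eventually.of_forall fun n => ht.trans_le (le_max_right _ _), fun t ht => ?_⟩
  filter_upwards [h t ht] with n hn using max_lt hn ht

/-! ### Convergence of the maximizers -/

section Convergence

variable {F : Measure ℝ} [IsProbabilityMeasure F] {Fn : ℕ → Measure ℝ}
  [∀ n, IsProbabilityMeasure (Fn n)]

theorem exists_real_eventually_le_L (hW : Tendsto (fun n => dW (Fn n) F) atTop (𝓝 0))
    (hA : ConditionA F) (hAn : ∀ n, ConditionA (Fn n)) :
    ∃ c : ℝ, ∀ᶠ n in atTop, (c : EReal) ≤ L (Fn n) := by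
  obtain ⟨c, -, hc⟩ := EReal.lt_iff_exists_real_btwn.1 (bot_lt_L hA.2)
  exact ⟨c, (eventually_lt_L hW hA (fun n => (hAn n).2) hc).mono fun n hn => hn.le⟩

/-- Upper semicontinuity of `Psi` and lower semicontinuity of `L` squeeze the limit pair to the
value `L F`, so it is the unique maximizer for `F`. -/
theorem exists_subseq_star_limit (hW : Tendsto (fun n => dW (Fn n) F) atTop (𝓝 0))
    (hA : ConditionA F) (hB : ConditionB F) (hAn : ∀ n, ConditionA (Fn n))
    (hBn : ∀ n, ConditionB (Fn n)) {ns : ℕ → ℕ} (hns : Tendsto ns atTop atTop) :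
    ∃ ms : ℕ → ℕ,
      Tendsto (fun n => thetaStar (Fn (ns (ms n)))) atTop (𝓝 (thetaStar F)) ∧
      (∀ x t, psiStar F x < t → ∀ᶠ n in atTop, psiStar (Fn (ns (ms n))) x < t) ∧
      (∀ x ∈ interior (dom (psiStar F)), ∀ t < psiStar F x,
        ∀ᶠ n in atTop, t < psiStar (Fn (ns (ms n))) x) ∧
      Tendsto (fun n => L (Fn (ns (ms n)))) atTop (𝓝 (L F)) := by
  obtain ⟨c, hc⟩ := exists_real_eventually_le_L hW hA hAn
  obtain ⟨N, hN⟩ := eventually_atTop.1 (hns.eventually hc)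
  have hs : ∀ n, IsMaximizer (Fn n) (thetaStar (Fn n)) (psiStar (Fn n)) := fun n =>
    (isMaximizer_iff_eq_star (hAn n) (hBn n) _ _).2 ⟨rfl, rfl⟩
  have hN' : Tendsto (fun n => ns (n + N)) atTop atTop := hns.comp (tendsto_add_atTop_nat N)
  obtain ⟨φ, hφ, θ, ψ, hψ, hθ, hup, hlo, hP⟩ := exists_subseq_limit
    (F := F) (Fn := fun n => Fn (ns (n + N))) (hW.comp hN') hA (fun n => (hAn _).2)
    (θn := fun n => thetaStar (Fn (ns (n + N)))) (ψn := fun n => psiStar (Fn (ns (n + N))))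
    (fun n => (hs _).1) (fun n => lintegral_exp_le_one_of_isMaximizer (hAn _).2 (hs _)) (c := c)
    (fun n => by rw [(IsMaximizer_iff.1 (hs _)).2]; exact hN _ (by omega))
  have hP' : ∀ t, Psi θ ψ F < t → ∀ᶠ n in atTop, L (Fn (ns (φ n + N))) < t := fun t ht => by
    filter_upwards [hP t ht] with n hn
    rwa [← (IsMaximizer_iff.1 (hs _)).2]
  have hlow : ∀ t < L F, ∀ᶠ n in atTop, t < L (Fn (ns (φ n + N))) := fun t ht =>
    (hN'.comp hφ.tendsto_atTop).eventually (eventually_lt_L hW hA (fun n => (hAn n).2) ht)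
  have hPL : Psi θ ψ F = L F := by
    refine le_antisymm (Psi_le_L hψ θ) ?_
    by_contra hlt
    obtain ⟨s, hs1, hs2⟩ := exists_between (not_le.1 hlt)
    obtain ⟨n, h1, h2⟩ := ((hP' s hs1).and (hlow s hs2)).exists
    exact absurd h1 (not_lt.2 h2.le)
  obtain ⟨rfl, rfl⟩ := (isMaximizer_iff_eq_star hA hB θ ψ).1 (IsMaximizer_iff.2 ⟨hψ, hPL⟩)
  exact ⟨fun n => φ n + N, hθ, hup, hlo, tendsto_order.2 ⟨hlow, fun t ht => hP' t (hPL ▸ ht)⟩⟩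

variable (hW : Tendsto (fun n => dW (Fn n) F) atTop (𝓝 0))
    (hA : ConditionA F) (hB : ConditionB F) (hAn : ∀ n, ConditionA (Fn n))
    (hBn : ∀ n, ConditionB (Fn n))

include hW hA hB hAn hBn

theorem tendsto_L : Tendsto (fun n => L (Fn n)) atTop (𝓝 (L F)) :=
  tendsto_of_subseq_tendsto fun _ hns => by
    obtain ⟨ms, -, -, -, h⟩ := exists_subseq_star_limit hW hA hB hAn hBn hns
    exact ⟨ms, h⟩

theorem tendsto_thetaStar : Tendsto (fun n => thetaStar (Fn n)) atTop (𝓝 (thetaStar F)) :=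
  tendsto_of_subseq_tendsto fun _ hns => by
    obtain ⟨ms, h, -⟩ := exists_subseq_star_limit hW hA hB hAn hBn hns
    exact ⟨ms, h⟩

theorem tendsto_max_psiStar (x : ℝ) :
    Tendsto (fun n => max (psiStar (Fn n) x) (psiStar F x)) atTop (𝓝 (psiStar F x)) :=
  tendsto_of_subseq_tendsto fun _ hns => by
    obtain ⟨ms, -, h, -⟩ := exists_subseq_star_limit hW hA hB hAn hBn hns
    exact ⟨ms, tendsto_max_of_forall_eventually_lt (h x)⟩

theorem tendsto_psiStar {x : ℝ} (hx : psiStar F x = ⊥ ∨ x ∈ interior (dom (psiStar F))) :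
    Tendsto (fun n => psiStar (Fn n) x) atTop (𝓝 (psiStar F x)) := by
  rcases hx with hx | hx
  · have := tendsto_max_psiStar hW hA hB hAn hBn x
    simpa only [hx, max_bot_right] using this
  · refine tendsto_of_subseq_tendsto fun _ hns => ?_
    obtain ⟨ms, -, hup, hlo, -⟩ := exists_subseq_star_limit hW hA hB hAn hBn hns
    exact ⟨ms, tendsto_order.2 ⟨hlo x hx, hup x⟩⟩

theorem limsup_psiStar_le (x : ℝ) :
    limsup (fun n => psiStar (Fn n) x) atTop ≤ psiStar F x := by
  rw [← (tendsto_max_psiStar hW hA hB hAn hBn x).limsup_eq]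
  exact limsup_le_limsup (Eventually.of_forall fun n => le_max_left _ _)

theorem tendsto_gStar {x : ℝ} (hx : psiStar F x = ⊥ ∨ x ∈ interior (dom (psiStar F))) :
    Tendsto (fun n => gStar (Fn n) x) atTop (𝓝 (gStar F x)) := by
  have hs : IsMaximizer F (thetaStar F) (psiStar F) :=
    (isMaximizer_iff_eq_star hA hB _ _).2 ⟨rfl, rfl⟩
  have hfin : EReal.exp (psiStar F x) ≠ ⊤ := by
    rw [Ne, EReal.exp_eq_top_iff]
    exact (hs.1.1.lt_top x).ne
  exact (ENNReal.tendsto_toReal hfin).comp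
    ((ENNReal.continuous_exp.tendsto _).comp (tendsto_psiStar hW hA hB hAn hBn hx))

omit hW hAn hBn in
theorem psiStar_eq_bot_of_gStar_eq_zero {x : ℝ} (hx : gStar F x = 0) : psiStar F x = ⊥ := by
  have hs : IsMaximizer F (thetaStar F) (psiStar F) :=
    (isMaximizer_iff_eq_star hA hB _ _).2 ⟨rfl, rfl⟩
  rcases (ENNReal.toReal_eq_zero_iff _).1 hx with h | h
  · exact EReal.exp_eq_zero_iff.1 h
  · exact absurd (EReal.exp_eq_top_iff.1 h) (hs.1.1.lt_top x).ne

theorem tendsto_gStar_of_frontier {x : ℝ}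
    (hx : x ∈ frontier (dom (psiStar F)) → gStar F x = 0) :
    Tendsto (fun n => gStar (Fn n) x) atTop (𝓝 (gStar F x)) := by
  refine tendsto_gStar hW hA hB hAn hBn ?_
  by_cases hd : psiStar F x = ⊥
  · exact Or.inl hd
  · refine Or.inr ?_
    by_contra hi
    exact hd (psiStar_eq_bot_of_gStar_eq_zero hA hB
      (hx ⟨subset_closure (bot_lt_iff_ne_bot.2 hd), hi⟩))

/-- The envelopes for `F` and for the tail of the sequence are weakened to the larger constant and
the smaller slope. -/
theorem exists_gStar_bound : ∃ D β : ℝ, 0 < β ∧ (∀ x, gStar F x ≤ Real.exp (D - β * |x|)) ∧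
    ∀ᶠ n in atTop, ∀ x, gStar (Fn n) x ≤ Real.exp (D - β * |x|) := by
  have hs : IsMaximizer F (thetaStar F) (psiStar F) :=
    (isMaximizer_iff_eq_star hA hB _ _).2 ⟨rfl, rfl⟩
  have hsn : ∀ n, IsMaximizer (Fn n) (thetaStar (Fn n)) (psiStar (Fn n)) := fun n =>
    (isMaximizer_iff_eq_star (hAn n) (hBn n) _ _).2 ⟨rfl, rfl⟩
  obtain ⟨c, hc⟩ := exists_real_eventually_le_L hW hA hAn
  obtain ⟨C, b, R, -, hb, hbd⟩ := eventually_uniform_bound hW hA (fun n => (hAn n).2) c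
  obtain ⟨M, hM⟩ := SC_zero_real hs.1
  have hbdF := SC_bound hs.1 (lintegral_exp_le_one_of_isMaximizer hA.2 hs) hM
  have key : ∀ (G : Measure ℝ) (C' b' : ℝ), C' ≤ max C (M + 1) →
      min b (2 * Real.exp (M - 1)) ≤ b' → (∀ x, psiStar G x ≤ ((C' - b' * |x| : ℝ) : EReal)) →
      ∀ x, gStar G x ≤ Real.exp (max C (M + 1) - min b (2 * Real.exp (M - 1)) * |x|) := by
    intro G C' b' hC hb h x
    refine ENNReal.toReal_le_of_le_ofReal (Real.exp_pos _).le ?_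
    rw [← EReal.exp_coe]
    refine EReal.exp_monotone ((h x).trans (EReal.coe_le_coe_iff.2 ?_))
    have := mul_le_mul_of_nonneg_right hb (abs_nonneg x)
    linarith
  refine ⟨max C (M + 1), min b (2 * Real.exp (M - 1)), lt_min hb (by positivity),
    key F _ _ (le_max_right _ _) (min_le_right _ _) hbdF, ?_⟩
  filter_upwards [hbd, hc] with n hn hcn
  refine key (Fn n) _ _ (le_max_left _ _) (min_le_left _ _) (hn (thetaStar (Fn n)) _ (hsn n).1
    (lintegral_exp_le_one_of_isMaximizer (hAn n).2 (hsn n)) ?_).2.1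
  rwa [(IsMaximizer_iff.1 (hsn n)).2]

end Convergence

/-! ### Exponentially weighted convergence -/

theorem exp_mul_abs_sub_le {D β α p q t : ℝ} (hp0 : 0 ≤ p) (hq0 : 0 ≤ q)
    (hp : p ≤ Real.exp (D - β * t)) (hq : q ≤ Real.exp (D - β * t)) :
    Real.exp (α * t) * |p - q| ≤ Real.exp (D - (β - α) * t) := by
  have h1 : |p - q| ≤ Real.exp (D - β * t) := abs_sub_le_iff.2 ⟨by linarith, by linarith⟩
  refine (mul_le_mul_of_nonneg_left h1 (Real.exp_pos _).le).trans_eq ?_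
  rw [← Real.exp_add]
  congr 1; ring

/-- Pólya's argument: near `x`, each `h n` is squeezed between its values at `x ± d / 2`, where it
is close to `f`, which itself barely varies there. -/
theorem tendstoLocallyUniformly_of_antitone {h : ℕ → ℝ → ℝ} {f : ℝ → ℝ} (hh : ∀ n, Antitone (h n))
    (hf : Continuous f) (hlim : ∀ x, Tendsto (fun n => h n x) atTop (𝓝 (f x))) :
    TendstoLocallyUniformly h f atTop := by
  rw [Metric.tendstoLocallyUniformly_iff]
  intro ε hε x
  obtain ⟨d, hd, hc⟩ := Metric.continuous_iff.1 hf x (ε / 4) (by linarith)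
  refine ⟨Set.Ioo (x - d / 2) (x + d / 2), Ioo_mem_nhds (by linarith) (by linarith), ?_⟩
  filter_upwards [Metric.tendsto_nhds.1 (hlim (x - d / 2)) (ε / 4) (by linarith),
    Metric.tendsto_nhds.1 (hlim (x + d / 2)) (ε / 4) (by linarith)] with n h1 h2 y hy
  have h3 := hh n hy.1.le
  have h4 := hh n hy.2.le
  have h5 := hc (x - d / 2) (by rw [Real.dist_eq, abs_lt]; constructor <;> linarith)
  have h6 := hc (x + d / 2) (by rw [Real.dist_eq, abs_lt]; constructor <;> linarith)
  have h7 := hc y (by rw [Real.dist_eq, abs_lt]; constructor <;> linarith [hy.1, hy.2])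
  rw [Real.dist_eq, abs_lt] at h1 h2 h5 h6 h7 ⊢
  constructor <;> linarith [h1.1, h1.2, h2.1, h2.2, h5.1, h5.2, h6.1, h6.2, h7.1, h7.2]

section Tail

variable {g : ℕ → ℝ → ℝ} {f : ℝ → ℝ} {D β : ℝ}

theorem tendsto_lintegral_exp_mul_abs_sub (hg0 : ∀ n x, 0 ≤ g n x) (hf0 : ∀ x, 0 ≤ f x)
    (hgm : ∀ n, Measurable (g n)) (hfm : Measurable f)
    (hf : ∀ x, f x ≤ Real.exp (D - β * |x|))
    (hg : ∀ᶠ n in atTop, ∀ x, g n x ≤ Real.exp (D - β * |x|))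
    (hlim : ∀ᵐ x, Tendsto (fun n => g n x) atTop (𝓝 (f x))) {α : ℝ} (hα : α < β) :
    Tendsto (fun n => ∫⁻ x : ℝ, ENNReal.ofReal (Real.exp (α * |x|) * |g n x - f x|))
      atTop (𝓝 0) := by
  rw [← lintegral_zero (μ := (volume : Measure ℝ))]
  refine tendsto_lintegral_filter_of_dominated_convergence
    (fun x => ENNReal.ofReal (Real.exp (D - (β - α) * |x|)))
    (Eventually.of_forall fun n => ?_) ?_
    (lintegral_exp_neg_mul_abs_lt_top (sub_pos.2 hα) D).ne ?_
  · exact ((Real.continuous_exp.comp (continuous_const.mul continuous_abs)).measurable.mul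
      ((hgm n).sub hfm).abs).ennreal_ofReal
  · filter_upwards [hg] with n hn
    exact Eventually.of_forall fun x =>
      ENNReal.ofReal_le_ofReal (exp_mul_abs_sub_le (hg0 n x) (hf0 x) (hn x) (hf x))
  · filter_upwards [hlim] with x hx
    have h1 := ((hx.sub_const (f x)).abs).const_mul (Real.exp (α * |x|))
    rw [sub_self, abs_zero, mul_zero] at h1
    simpa using ENNReal.tendsto_ofReal h1

theorem tendsto_iSup_exp_mul_abs_sub (hg0 : ∀ n x, 0 ≤ g n x) (hf0 : ∀ x, 0 ≤ f x)
    (hga : ∀ n x y, |x| ≤ |y| → g n y ≤ g n x) (hfe : ∀ x, f |x| = f x)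
    (hf : ∀ x, f x ≤ Real.exp (D - β * |x|))
    (hg : ∀ᶠ n in atTop, ∀ x, g n x ≤ Real.exp (D - β * |x|)) (hfc : Continuous f)
    (hlim : ∀ x, Tendsto (fun n => g n x) atTop (𝓝 (f x))) {α : ℝ} (hα : α < β) :
    Tendsto (fun n => ⨆ x : ℝ, ENNReal.ofReal (Real.exp (α * |x|) * |g n x - f x|))
      atTop (𝓝 0) := by
  rw [ENNReal.tendsto_nhds_zero]
  intro ε' hε'
  obtain ⟨ε, hε0, hεε⟩ := ENNReal.lt_iff_exists_nnreal_btwn.1 hε'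
  have hε : (0 : ℝ) < ε := by exact_mod_cast hε0
  have ht : Tendsto (fun R : ℝ => Real.exp (D - (β - α) * R)) atTop (𝓝 0) :=
    Real.tendsto_exp_atBot.comp (tendsto_atBot_add_const_left _ D
      (tendsto_neg_atTop_atBot.comp (tendsto_id.const_mul_atTop (sub_pos.2 hα))))
  obtain ⟨R, hR, hR0⟩ := ((ht.eventually (gt_mem_nhds hε)).and (eventually_ge_atTop 0)).exists
  -- Clipping the argument at `0` turns monotonicity in `|x|` into antitonicity on the whole line.
  -- Beyond radius `R` the envelope alone gives the bound.
  have hunif := tendstoLocallyUniformly_iff_forall_isCompact.1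
    (tendstoLocallyUniformly_of_antitone (h := fun n t => g n (max t 0)) (f := fun t => f (max t 0))
      (fun n s t hst => hga n _ _ (by
        rw [abs_of_nonneg (le_max_right _ _), abs_of_nonneg (le_max_right _ _)]
        exact max_le_max_right 0 hst))
      (hfc.comp (continuous_id.max continuous_const)) fun x => hlim _) (Set.Icc 0 R) isCompact_Icc
  have hw : 0 < Real.exp (|α| * R) := Real.exp_pos _
  filter_upwards [hg, Metric.tendstoUniformlyOn_iff.1 hunif (ε / Real.exp (|α| * R))
    (div_pos hε hw)] with n hn hu
  refine iSup_le fun x => le_trans ?_ hεε.le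
  rw [← ENNReal.ofReal_coe_nnreal]
  refine ENNReal.ofReal_le_ofReal ?_
  rcases le_total |x| R with hx | hx
  · have h1 := hu |x| ⟨abs_nonneg x, hx⟩
    have h2 : g n |x| = g n x := le_antisymm (hga n _ _ (by simp)) (hga n _ _ (by simp))
    rw [max_eq_left (abs_nonneg x), hfe, h2, dist_comm, Real.dist_eq, lt_div_iff₀ hw] at h1
    have h3 : Real.exp (α * |x|) ≤ Real.exp (|α| * R) := by
      refine Real.exp_le_exp.2 ((mul_le_mul_of_nonneg_right (le_abs_self α) (abs_nonneg x)).trans ?_)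
      exact mul_le_mul_of_nonneg_left hx (abs_nonneg α)
    have := mul_le_mul_of_nonneg_right h3 (abs_nonneg (g n x - f x))
    linarith
  · refine (exp_mul_abs_sub_le (hg0 n x) (hf0 x) (hn x) (hf x)).trans (le_trans ?_ hR.le)
    refine Real.exp_le_exp.2 ?_
    have := mul_le_mul_of_nonneg_left hx (sub_pos.2 hα).le
    linarith

end Tail

theorem gStar_anti {G : Measure ℝ} (h : psiStar G ∈ SC 0) {x y : ℝ} (hxy : |x| ≤ |y|) :
    gStar G y ≤ gStar G x := by
  refine ENNReal.toReal_mono ?_ (EReal.exp_monotone (SC_anti h hxy))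
  rw [Ne, EReal.exp_eq_top_iff]
  exact (h.1.lt_top x).ne

/-- By continuity, a point where `gStar G` is nonzero has a neighbourhood inside the domain, so it
is not on the frontier. -/
theorem gStar_eq_zero_of_mem_frontier {G : Measure ℝ} (hc : Continuous (gStar G))
    {x : ℝ} (hx : x ∈ frontier (dom (psiStar G))) : gStar G x = 0 := by
  by_contra hne
  have h1 : ∀ᶠ y in 𝓝 x, gStar G y ≠ 0 := hc.continuousAt.eventually_ne hne
  refine hx.2 (mem_interior_iff_mem_nhds.2 (Filter.mem_of_superset h1 fun y hy => ?_))
  change ⊥ < psiStar G y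
  refine bot_lt_iff_ne_bot.2 fun hb => hy ?_
  rw [gStar, hb, EReal.exp_bot, ENNReal.toReal_zero]

end SymLogConcave

theorem mainTheorem5
    (F : Measure ℝ) [IsProbabilityMeasure F]
    (Fn : ℕ → Measure ℝ) [∀ n, IsProbabilityMeasure (Fn n)]
    (hW : Tendsto (fun n => SymLogConcave.dW (Fn n) F) atTop (𝓝 0))
    (hA : SymLogConcave.ConditionA F) (hB : SymLogConcave.ConditionB F)
    (hAn : ∀ n, SymLogConcave.ConditionA (Fn n))
    (hBn : ∀ n, SymLogConcave.ConditionB (Fn n)) :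
    -- the maximizing pairs exist and are unique
    (∀ θ ψ, SymLogConcave.IsMaximizer F θ ψ ↔
      θ = SymLogConcave.thetaStar F ∧ ψ = SymLogConcave.psiStar F) ∧
    (∀ n θ ψ, SymLogConcave.IsMaximizer (Fn n) θ ψ ↔
      θ = SymLogConcave.thetaStar (Fn n) ∧ ψ = SymLogConcave.psiStar (Fn n)) ∧
    -- convergence of the maximized criterion function
    Tendsto (fun n => SymLogConcave.L (Fn n)) atTop (𝓝 (SymLogConcave.L F)) ∧
    -- (a)
    Tendsto (fun n => SymLogConcave.thetaStar (Fn n)) atTop (𝓝 (SymLogConcave.thetaStar F)) ∧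
    -- (b)
    (∀ x ∈ interior (SymLogConcave.dom (SymLogConcave.psiStar F)),
      Tendsto (fun n => SymLogConcave.psiStar (Fn n) x) atTop
        (𝓝 (SymLogConcave.psiStar F x))) ∧
    -- (c)
    (∀ x : ℝ, limsup (fun n => SymLogConcave.psiStar (Fn n) x) atTop ≤
      SymLogConcave.psiStar F x) ∧
    -- (d)
    (∀ x : ℝ,
      (x ∈ frontier (SymLogConcave.dom (SymLogConcave.psiStar F)) →
        SymLogConcave.gStar F x = 0) →
      Tendsto (fun n => SymLogConcave.gStar (Fn n) x) atTop (𝓝 (SymLogConcave.gStar F x))) ∧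
    -- (e)
    (∃ α : ℝ, 0 < α ∧ ∀ α₁ : ℝ, α₁ < α →
      Tendsto (fun n => ∫⁻ x : ℝ, ENNReal.ofReal
          (Real.exp (α₁ * |x|) * |SymLogConcave.gStar (Fn n) x - SymLogConcave.gStar F x|))
        atTop (𝓝 0) ∧
      (Continuous (SymLogConcave.gStar F) →
        Tendsto (fun n => ⨆ x : ℝ, ENNReal.ofReal
            (Real.exp (α₁ * |x|) * |SymLogConcave.gStar (Fn n) x - SymLogConcave.gStar F x|))
          atTop (𝓝 0))) := by

  have hs : SymLogConcave.IsMaximizer F (SymLogConcave.thetaStar F) (SymLogConcave.psiStar F) :=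
    (SymLogConcave.isMaximizer_iff_eq_star hA hB _ _).2 ⟨rfl, rfl⟩
  have hsn : ∀ n, SymLogConcave.IsMaximizer (Fn n) (SymLogConcave.thetaStar (Fn n))
      (SymLogConcave.psiStar (Fn n)) := fun n =>
    (SymLogConcave.isMaximizer_iff_eq_star (hAn n) (hBn n) _ _).2 ⟨rfl, rfl⟩
  refine ⟨SymLogConcave.isMaximizer_iff_eq_star hA hB,
    fun n => SymLogConcave.isMaximizer_iff_eq_star (hAn n) (hBn n),
    SymLogConcave.tendsto_L hW hA hB hAn hBn, SymLogConcave.tendsto_thetaStar hW hA hB hAn hBn,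
    fun x hx => SymLogConcave.tendsto_psiStar hW hA hB hAn hBn (Or.inr hx),
    SymLogConcave.limsup_psiStar_le hW hA hB hAn hBn,
    fun x => SymLogConcave.tendsto_gStar_of_frontier hW hA hB hAn hBn, ?_⟩
  obtain ⟨D, β, hβ, hF, hFn⟩ := SymLogConcave.exists_gStar_bound hW hA hB hAn hBn
  -- The threshold `α` is the decay rate of the common envelope.
  refine ⟨β, hβ, fun α₁ hα => ⟨?_, fun hcont => ?_⟩⟩
  · refine SymLogConcave.tendsto_lintegral_exp_mul_abs_sub
      (g := fun n => SymLogConcave.gStar (Fn n)) (f := SymLogConcave.gStar F)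
      (fun _ _ => ENNReal.toReal_nonneg)
      (fun _ => ENNReal.toReal_nonneg)
      (fun n => (SymLogConcave.SC_measurable_exp (hsn n).1).ennreal_toReal)
      (SymLogConcave.SC_measurable_exp hs.1).ennreal_toReal hF hFn ?_ hα
    filter_upwards [SymLogConcave.ae_mem_interior_dom hs.1] with x hx
    exact SymLogConcave.tendsto_gStar hW hA hB hAn hBn hx
  · exact SymLogConcave.tendsto_iSup_exp_mul_abs_sub
      (g := fun n => SymLogConcave.gStar (Fn n)) (f := SymLogConcave.gStar F)
      (fun _ _ => ENNReal.toReal_nonneg)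
      (fun _ => ENNReal.toReal_nonneg) (fun n x y => SymLogConcave.gStar_anti (hsn n).1)
      (fun x => congrArg (fun z => (EReal.exp z).toReal) (SymLogConcave.SC_abs hs.1 x)) hF hFn hcont
      (fun x => SymLogConcave.tendsto_gStar_of_frontier hW hA hB hAn hBn
        (SymLogConcave.gStar_eq_zero_of_mem_frontier hcont)) hα
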